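/- **Setting.** Let $(\Omega,\mathcal F,\mathbb P)$ be a probability space and let $(\mathbf X_n)_{n\ge1}$ and $(\mathbf y_n)_{n\ge1}$ be sequences of random elements of $\mathbb R^{N\times Q}$ and $\mathbb R^Q$. Put $\mathcal X_n=\sigma((\mathbf X_k,\mathbf y_k)_{1\le k\le n})$, $\varrho=\mathbb E\|\mathbf y_1\|^2$, $\mathbf r=\mathbb E(\mathbf X_1\mathbf y_1)$, $\mathbf R=\mathbb E(\mathbf X_1\mathbf X_1^\top)$. Let $$\Psi(\mathbf h)=\tfrac12\mathbf h^\top\mathbf V_0\mathbf h-\mathbf v_0^\top\mathbf h+\sum_{s=1}^S\psi_s(\|\mathbf V_s\mathbf h-\mathbf v_s\|),\qquad \mathbf h\in\mathbb R^N,$$ where $\mathbf V_0\in\mathbb R^{N\times N}$ is symmetric positive semi-definite, $\mathbf v_0\in\mathbb R^N$, $\mathbf V_s\in\mathbb R^{P_s\times N}$, $\mathbf v_s\in\mathbb R^{P_s}$ and $\psi_s:\mathbb R\to\mathbb R$, and let $$F(\mathbf h)=\tfrac12\mathbb E\|\mathbf y_1-\mathbf X_1^\top\mathbf h\|^2+\Psi(\mathbf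 h),\qquad F_n(\mathbf h)=\frac1{2n}\sum_{k=1}^n\|\mathbf y_k-\mathbf X_k^\top\mathbf h\|^2+\Psi(\mathbf h).$$ Write $\nu_s(t)=\dot\psi_s(t)/t$, extended by continuity at $t=0$, and $$\mathbf A_n(\mathbf h)=\frac1n\sum_{k=1}^n\mathbf X_k\mathbf X_k^\top+\mathbf V_0+\sum_{s=1}^S\nu_s(\|\mathbf V_s\mathbf h-\mathbf v_s\|)\mathbf V_s^\top\mathbf V_s,$$ $$\Theta_n(\mathbf h',\mathbf h)=F_n(\mathbf h)+\nabla F_n(\mathbf h)^\top(\mathbf h'-\mathbf h)+\tfrac12(\mathbf h'-\mathbf h)^\top\mathbf A_n(\mathbf h)(\mathbf h'-\mathbf h).$$ Let $\mathbf D_n$ be random matrices in $\mathbb R^{N\times M_n}$ and let $(\mathbf h_n)_{n\ge1}$ be random vectors of $\mathbb R^N$ such that, almost surely, for every $n\ge1$, $$\mathbf h_{n+1}\in\operatorname*{arg\,min}_{\mathbf h\in\operatorname{ran}\mathbf D_n}\Theta_n(\mathbf h,\mathbf h_n);$$ where this minimizer is not unique, it is selected non-anticipatively, that is, for each $n$ there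 is an $\mathcal X_n$-measurable random vector with which $\mathbf h_{n+1}$ coincides almost surely on the event that the minimizer is not unique. **Assumptions.** 1. Each $\psi_s$ is even, bounded below and continuously differentiable, $\lim_{t\to0,\,t\ne0}\dot\psi_s(t)/t$ exists in $\mathbb R$, $\psi_s(\sqrt{\cdot})$ is concave on $[0,+\infty)$, and there is $\bar\nu\in[0,+\infty)$ with $0\le\nu_s(t)\le\bar\nu$ for all $s$ and all $t\ge0$. 2. Almost surely, for every $n\ge1$, $\nabla F_n(\mathbf h_n)$ and $\mathbf h_n$ belong to $\operatorname{ran}\mathbf D_n$. 3. (i) $\mathbf R+\mathbf V_0$ is positive definite. (ii) $((\mathbf X_n,\mathbf y_n))_{n\ge1}$ is a stationary ergodic sequence and all entries of $\mathbf X_n$ and $\mathbf y_n$ have finite fourth-order moments. (iii) For every $n\ge1$, almost surely, $\mathbb E(\|\mathbf y_{n+1}\|^2\mid\mathcal X_n)=\varrho$, $\mathbb E(\mathbf X_{n+1}\mathbf y_{n+1}\mid\mathcal X_n)=\mathbf r$ and $\mathbb E(\mathbf X_{n+1}\mathbf X_{n+1}^\top\mid\mathcal X_n)=\mathbf R$.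 (iv) $\mathbf h_1$ is $\mathcal X_1$-measurable and, for every $n\ge1$, $\mathbf D_n$ is $\mathcal X_n$-measurable. **Proposition 2.** Under these assumptions the following hold. (i) Almost surely, the set of cluster points of $(\mathbf h_n)_{n\ge1}$ is a nonempty compact connected set. (ii) Almost surely, every cluster point of $(\mathbf h_n)_{n\ge1}$ is a critical point of $F$, i.e. $F$ is differentiable there with zero gradient. (iii) If all the functions $\psi_s$ are convex, then $F$ has a unique global minimizer and $(\mathbf h_n)_{n\ge1}$ converges almost surely to it. -/

import Mathlib

open MeasureTheory Filter Topology Set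
open scoped Matrix Gradient

noncomputable section

namespace OnlineMM

/-! Sequences indexed by `n ≥ 1` in the mathematics are indexed by `n : ℕ` here, with a shift:
`X n`, `y n`, `h n`, `D n`, ... stand for `X_{n+1}`, `y_{n+1}`, `h_{n+1}`, `D_{n+1}`, ... -/

/-- `ℝ^d` with its Euclidean norm. -/
abbrev Vec (d : ℕ) := EuclideanSpace ℝ (Fin d)

/-- The product `A x` of a matrix with a Euclidean vector. -/
abbrev app {m n : ℕ} (A : Matrix (Fin m) (Fin n) ℝ) (x : Vec n) : Vec m :=
  Matrix.toEuclideanLin A x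

/-- The Borel (product) sigma-algebra on real matrices. -/
instance instMeasurableSpaceMatrix {m n : ℕ} : MeasurableSpace (Matrix (Fin m) (Fin n) ℝ) :=
  inferInstanceAs (MeasurableSpace (Fin m → Fin n → ℝ))

/-- The data of the regularization function
`Ψ(h) = ½ hᵀ V₀ h - v₀ᵀ h + ∑ₛ ψₛ(‖Vₛ h - vₛ‖)`. -/
structure Regularizer (N : ℕ) where
  /-- the number of potential functions -/
  S : ℕ
  V₀ : Matrix (Fin N) (Fin N) ℝ
  /-- `V₀` is symmetric positive semi-definite -/
  posSemidef_V₀ : V₀.PosSemidef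
  v₀ : Vec N
  P : Fin S → ℕ
  V : (s : Fin S) → Matrix (Fin (P s)) (Fin N) ℝ
  v : (s : Fin S) → Vec (P s)
  ψ : Fin S → ℝ → ℝ

/-- `ν(t) = ψ'(t) / t`, extended by continuity at `t = 0`. -/
def weight (ψ : ℝ → ℝ) (t : ℝ) : ℝ :=
  if t = 0 then limUnder (𝓝[≠] (0 : ℝ)) (fun u => deriv ψ u / u) else deriv ψ t / t

namespace Regularizer

variable {N : ℕ} (reg : Regularizer N)

/-- The regularization function `Ψ`. -/
def Ψ (h : Vec N) : ℝ :=
  (1 / 2) * inner ℝ h (app reg.V₀ h) - inner ℝ reg.v₀ h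
    + ∑ s, reg.ψ s ‖app (reg.V s) h - reg.v s‖

/-- Row indices of the stacked matrix `[V₁ᵀ … V_Sᵀ]ᵀ`. -/
abbrev Row := (s : Fin reg.S) × Fin (reg.P s)

/-- The stacked matrix `[V₁ᵀ … V_Sᵀ]ᵀ`. -/
def stack : Matrix reg.Row (Fin N) ℝ :=
  Matrix.of fun i j => reg.V i.1 i.2 j

/-- The vector `b(h)`, equal to `νₛ(‖Vₛ h - vₛ‖)` on the whole `s`-th block. -/
def b (h : Vec N) (i : reg.Row) : ℝ :=
  weight (reg.ψ i.1) ‖app (reg.V i.1) h - reg.v i.1‖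

/-- The conditions on the potential functions `ψₛ`. -/
structure Assumption1 : Prop where
  even : ∀ s t, reg.ψ s (-t) = reg.ψ s t
  bddBelow : ∀ s, BddBelow (range (reg.ψ s))
  contDiff : ∀ s, ContDiff ℝ 1 (reg.ψ s)
  limit_zero : ∀ s, ∃ l : ℝ, Tendsto (fun t => deriv (reg.ψ s) t / t) (𝓝[≠] 0) (𝓝 l)
  concave_sqrt : ∀ s, ConcaveOn ℝ (Ici 0) (fun t => reg.ψ s (Real.sqrt t))
  weight_bounded : ∃ νbar : ℝ, 0 ≤ νbar ∧
    ∀ s t, 0 ≤ t → 0 ≤ weight (reg.ψ s) t ∧ weight (reg.ψ s) t ≤ νbar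

end Regularizer

section Algorithm

variable {N Q : ℕ} (reg : Regularizer N)
  (x : ℕ → Matrix (Fin N) (Fin Q) ℝ) (y : ℕ → Vec Q)

/-- The sample matrix `(1/n) ∑_{k ≤ n} X_k X_kᵀ` (indices shifted, forgetting factor `1`). -/
def sampleR (n : ℕ) : Matrix (Fin N) (Fin N) ℝ :=
  ((n : ℝ) + 1)⁻¹ • ∑ k ∈ Finset.range (n + 1), x k * (x k)ᵀ

/-- The stochastic approximation
`F_n(h) = (1/(2n)) ∑_{k ≤ n} ‖y_k - X_kᵀ h‖² + Ψ(h)` (indices shifted, forgetting factor `1`). -/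
def sampleCost (n : ℕ) (h : Vec N) : ℝ :=
  (2 * ((n : ℝ) + 1))⁻¹ * ∑ k ∈ Finset.range (n + 1), ‖y k - app (x k)ᵀ h‖ ^ 2 + reg.Ψ h

/-- The curvature matrix `A_n(h) = R_n + V₀ + Vᵀ Diag(b(h)) V`. -/
def curvature (n : ℕ) (h : Vec N) : Matrix (Fin N) (Fin N) ℝ :=
  sampleR x n + reg.V₀ + reg.stackᵀ * Matrix.diagonal (reg.b h) * reg.stack

/-- The quadratic surrogate `Θ_n(h', h)`. -/
def surrogate (n : ℕ) (h' h : Vec N) : ℝ :=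
  sampleCost reg x y n h + inner ℝ (∇ (sampleCost reg x y n) h) (h' - h)
    + (1 / 2) * inner ℝ (h' - h) (app (curvature reg x n h) (h' - h))

/-- The range of a matrix. -/
abbrev ran {M : ℕ} (D : Matrix (Fin N) (Fin M) ℝ) : Submodule ℝ (Vec N) :=
  LinearMap.range (Matrix.toEuclideanLin D)

/-- The set of minimizers of `Θ_n(·, h)` over `ran D`. -/
def argminSurrogate (n : ℕ) (h : Vec N) {M : ℕ} (D : Matrix (Fin N) (Fin M) ℝ) : Set (Vec N) :=
  {z | z ∈ ran D ∧ ∀ z' ∈ ran D, surrogate reg x y n z h ≤ surrogate reg x y n z' h}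

end Algorithm

section Stochastic

variable {Ω : Type*} {N Q : ℕ}
  (X : ℕ → Ω → Matrix (Fin N) (Fin Q) ℝ) (y : ℕ → Ω → Vec Q)

/-- The sigma-algebra generated by the first observations `(X_k, y_k)`, `k ≤ n`. -/
@[reducible]
def dataSigma (n : ℕ) : MeasurableSpace Ω :=
  ⨆ (k : ℕ) (_ : k ≤ n), MeasurableSpace.comap (fun ω => (X k ω, y k ω)) inferInstance

variable [MeasurableSpace Ω] (μ : Measure Ω) (reg : Regularizer N)

/-- `ϱ = E ‖y‖²`. -/
def momentY : ℝ := ∫ ω, ‖y 0 ω‖ ^ 2 ∂μ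

/-- `r = E (X y)`. -/
def momentXY : Vec N := WithLp.toLp 2 fun i => ∫ ω, app (X 0 ω) (y 0 ω) i ∂μ

/-- `R = E (X Xᵀ)`. -/
def momentXX : Matrix (Fin N) (Fin N) ℝ :=
  Matrix.of fun i j => ∫ ω, (X 0 ω * (X 0 ω)ᵀ) i j ∂μ

/-- The limit cost `F(h) = ½ E ‖y - Xᵀ h‖² + Ψ(h)`. -/
def cost (h : Vec N) : ℝ := (1 / 2) * ∫ ω, ‖y 0 ω - app (X 0 ω)ᵀ h‖ ^ 2 ∂μ + reg.Ψ h

/-- `((X_n, y_n))_n` is a stationary ergodic sequence: its law on the space of sequences is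
invariant and ergodic under the shift. -/
def IsStationaryErgodic : Prop :=
  Ergodic (fun (z : ℕ → Matrix (Fin N) (Fin Q) ℝ × Vec Q) n => z (n + 1))
    (μ.map fun ω n => (X n ω, y n ω))

variable (M : ℕ → ℕ) (D : (n : ℕ) → Ω → Matrix (Fin N) (Fin (M n)) ℝ) (h : ℕ → Ω → Vec N)

/-- `(h_n)` is generated by the online MM subspace algorithm,
`h_{n+1} ∈ argmin_{ran D_n} Θ_n(·, h_n)`. Whenever this argmin is not a singleton, the choice of
`h_{n+1}` in it is non-anticipative, i.e. given by a random vector that is measurable with respect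
to the first `n` observations. -/
structure IsMMSubspaceSequence : Prop where
  mem_argmin : ∀ᵐ ω ∂μ, ∀ n,
    h (n + 1) ω ∈ argminSurrogate reg (X · ω) (y · ω) n (h n ω) (D n ω)
  selection : ∀ n, ∃ g : Ω → Vec N, Measurable[dataSigma X y n] g ∧
    ∀ᵐ ω ∂μ, ¬ (argminSurrogate reg (X · ω) (y · ω) n (h n ω) (D n ω)).Subsingleton →
      h (n + 1) ω = g ω

/-- The subspaces contain the current gradient and the current iterate. -/
def Assumption2 : Prop :=
  ∀ᵐ ω ∂μ, ∀ n,
    ∇ (sampleCost reg (X · ω) (y · ω) n) (h n ω) ∈ ran (D n ω) ∧ h n ω ∈ ran (D n ω)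

/-- The probabilistic conditions on the observations and on the algorithm. -/
structure Assumption3 : Prop where
  posDef : (momentXX X μ + reg.V₀).PosDef
  stationary_ergodic : IsStationaryErgodic X y μ
  moment_X : ∀ n i j, MemLp (fun ω => X n ω i j) 4 μ
  moment_y : ∀ n i, MemLp (fun ω => y n ω i) 4 μ
  condExp_y : ∀ n, μ[fun ω => ‖y (n + 1) ω‖ ^ 2 | dataSigma X y n] =ᵐ[μ] fun _ => momentY y μ
  condExp_Xy : ∀ n i, μ[fun ω => app (X (n + 1) ω) (y (n + 1) ω) i | dataSigma X y n]
    =ᵐ[μ] fun _ => momentXY X y μ i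
  condExp_XX : ∀ n i j, μ[fun ω => (X (n + 1) ω * (X (n + 1) ω)ᵀ) i j | dataSigma X y n]
    =ᵐ[μ] fun _ => momentXX X μ i j
  measurable_init : Measurable[dataSigma X y 0] (h 0)
  measurable_D : ∀ n i j, Measurable[dataSigma X y n] (fun ω => D n ω i j)

end Stochastic

/-- The set of cluster points of a sequence. -/
def clusterPoints {E : Type*} [TopologicalSpace E] (u : ℕ → E) : Set E :=
  {z | MapClusterPt z atTop u}

end OnlineMM

end

/-! ### Potential functions -/

namespace OnlineMM

/-! Up to a constant, the sample cost is `½⟨x, Bₙ x⟩ - ⟨cₙ, x⟩ + Φ x`, where `Bₙ` and `cₙ` are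
empirical means (plus `V₀`, `v₀`) and `Φ` is the penalty. Concavity of `ψₛ(√·)` gives `Φ` a tangent
quadratic majorant at each `h`, of curvature `P h` and gradient `P h h - p h` (`penalty_le`).
Minimizing the surrogate over `ran Dₙ` thus amounts to normal equations tested against `ran Dₙ`
(`mem_argminSurrogate_iff`).

Three test vectors drive the argument along a trajectory. The new iterate gives boundedness, since
`Bₙ` is eventually coercive and `p` is bounded. The increment gives a decrease of the `n`-th cost by
at least `½⟨δ, Bₙ δ⟩`. The gradient gives `‖∇Fₙ(hₙ)‖ = O(‖hₙ₊₁ - hₙ‖)`. If the changes of cost from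
`n` to `n + 1`, taken at `hₙ₊₁`, have bounded partial sums, the squared increments are summable.
Increments and gradients then vanish, so the cluster set is connected and consists of critical
points (`clusterPoints_properties`).

The bounded partial sums are the probabilistic core. The change of an empirical mean is a new
martingale difference over `n + 2` minus the old mean over `n + 2` (`mean_increment`). Weighted by
bounded predictable coordinates of `hₙ₊₁`, the first part is a convergent martingale transform; the
second is absolutely summable because the centred mean is `O(n^(-1/2))` in `L¹`. The same estimates
give the law of large numbers for `Bₙ` and `cₙ`.

Predictability of `hₙ₊₁` needs proof: a unique minimizer is a limit of Tikhonov-regularized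
solutions, which depend measurably on the data (`limitSolution_eq`), and otherwise the selection
hypothesis applies.

In the convex case a critical point is a strict global minimizer, so there is only one possible
cluster point. -/

/-- A differentiable convex function lies above its tangents. -/
theorem tangent_le_of_convexOn {f : ℝ → ℝ} {S : Set ℝ} (hf : ConvexOn ℝ S f) {x y f' : ℝ}
    (hx : x ∈ S) (hy : y ∈ S) (hd : HasDerivAt f f' x) : f x + f' * (y - x) ≤ f y := by
  rcases lt_trichotomy x y with hxy | rfl | hxy
  · have := hf.le_slope_of_hasDerivAt hx hy hxy hd
    rw [slope_def_field, le_div_iff₀ (by linarith)] at this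
    linarith
  · simp
  · have := hf.slope_le_of_hasDerivAt hy hx hxy hd
    rw [slope_def_field, div_le_iff₀ (by linarith)] at this
    linarith

/-- A differentiable concave function lies below its tangents. -/
theorem le_tangent_of_concaveOn {f : ℝ → ℝ} {S : Set ℝ} (hf : ConcaveOn ℝ S f) {x y f' : ℝ}
    (hx : x ∈ S) (hy : y ∈ S) (hd : HasDerivAt f f' x) : f y ≤ f x + f' * (y - x) := by
  have := tangent_le_of_convexOn hf.neg hx hy hd.neg
  simp only [Pi.neg_apply] at this
  linarith

/-- The conditions on a single potential function. -/
structure IsPotential (ψ : ℝ → ℝ) : Prop where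
  even : ∀ t, ψ (-t) = ψ t
  contDiff : ContDiff ℝ 1 ψ
  limit_zero : ∃ l : ℝ, Tendsto (fun t => deriv ψ t / t) (𝓝[≠] 0) (𝓝 l)
  concave_sqrt : ConcaveOn ℝ (Ici 0) (fun t => ψ (Real.sqrt t))
  weight_nonneg : ∀ t, 0 ≤ t → 0 ≤ weight ψ t

namespace IsPotential

variable {ψ : ℝ → ℝ} (hψ : IsPotential ψ)
include hψ

theorem hasDerivAt (t : ℝ) : HasDerivAt ψ (deriv ψ t) t :=
  (hψ.contDiff.differentiable (by norm_num) t).hasDerivAt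

theorem deriv_zero : deriv ψ 0 = 0 := by
  have h := hψ.hasDerivAt 0
  have h' : HasDerivAt (fun t => ψ (-t)) (-deriv ψ 0) 0 := by
    have h0 : HasDerivAt ψ (deriv ψ 0) (-0) := by simpa using h
    have h2 := h0.comp (0 : ℝ) (hasDerivAt_neg 0)
    rw [mul_neg_one] at h2
    exact h2
  rw [show (fun t => ψ (-t)) = ψ from funext hψ.even] at h'
  linarith [h.unique h']

/-- Evenness forces `ψ'(0) = 0`, so the identity needs no exception at the origin. -/
theorem deriv_eq (t : ℝ) : deriv ψ t = weight ψ t * t := by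
  unfold weight
  split_ifs with h
  · simp [h, hψ.deriv_zero]
  · field_simp

theorem tendsto_weight_zero :
    Tendsto (fun t => deriv ψ t / t) (𝓝[≠] 0) (𝓝 (weight ψ 0)) := by
  simpa [weight] using tendsto_nhds_limUnder hψ.limit_zero

theorem continuous_weight : Continuous (weight ψ) := by
  rw [continuous_iff_continuousAt]
  intro t
  by_cases ht : t = 0
  · subst ht
    rw [continuousAt_iff_punctured_nhds]
    refine hψ.tendsto_weight_zero.congr' ?_
    filter_upwards [self_mem_nhdsWithin] with t ht
    simp only [mem_compl_iff, mem_singleton_iff] at ht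
    simp [weight, ht]
  · have hc : Continuous (deriv ψ) := hψ.contDiff.continuous_deriv (by norm_num)
    have : ContinuousAt (fun t => deriv ψ t / t) t := hc.continuousAt.div continuousAt_id ht
    refine this.congr ?_
    filter_upwards [isOpen_ne.mem_nhds ht] with u hu
    simp [weight, show u ≠ 0 from hu]

/-- The concave function `u ↦ ψ(√u)` has slope `ψ'(t)/(2t)` at `u = t²`; this is its tangent
inequality, read at `u = t'²`. -/
theorem le_quadratic {t t' : ℝ} (ht : 0 ≤ t) (ht' : 0 ≤ t') :
    ψ t' ≤ ψ t + weight ψ t / 2 * (t' ^ 2 - t ^ 2) := by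
  have pos : ∀ t : ℝ, 0 < t → ψ t' ≤ ψ t + weight ψ t / 2 * (t' ^ 2 - t ^ 2) := by
    intro t ht
    have hs : Real.sqrt (t ^ 2) = t := Real.sqrt_sq ht.le
    have hd : HasDerivAt (fun u => ψ (Real.sqrt u)) (weight ψ t / 2) (t ^ 2) := by
      have h1 : HasDerivAt ψ (deriv ψ t) (Real.sqrt (t ^ 2)) := by rw [hs]; exact hψ.hasDerivAt t
      have h2 := h1.comp (t ^ 2) (Real.hasDerivAt_sqrt (pow_pos ht 2).ne')
      have h3 : deriv ψ t * (1 / (2 * Real.sqrt (t ^ 2))) = weight ψ t / 2 := by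
        rw [hs, hψ.deriv_eq]
        field_simp
      rwa [h3] at h2
    have := le_tangent_of_concaveOn hψ.concave_sqrt (x := t ^ 2) (y := t' ^ 2)
      (mem_Ici.2 (sq_nonneg _)) (mem_Ici.2 (sq_nonneg _)) hd
    simpa [hs, Real.sqrt_sq ht'] using this
  rcases ht.eq_or_lt with rfl | ht
  -- The square root is not differentiable at `0`, so the case `t = 0` is a limit from the right.
  · have hc : Continuous fun t => ψ t + weight ψ t / 2 * (t' ^ 2 - t ^ 2) := by
      have := hψ.continuous_weight
      have := hψ.contDiff.continuous
      fun_prop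
    refine ge_of_tendsto ((hc.tendsto 0).mono_left (nhdsWithin_le_nhds (s := Ioi 0))) ?_
    filter_upwards [self_mem_nhdsWithin] with t ht using pos t ht
  · exact pos t ht

variable {F : Type*} [NormedAddCommGroup F] [InnerProductSpace ℝ F]

/-- Away from `0` this is the chain rule with `ψ'(‖w‖)/‖w‖` as weight. At `0` the norm is not
differentiable, but `ψ'(0) = 0` makes the variation `o(‖w‖)`. -/
theorem hasFDerivAt_comp_norm (w : F) :
    HasFDerivAt (fun w => ψ ‖w‖) (weight ψ ‖w‖ • innerSL ℝ w) w := by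
  by_cases hw : w = 0
  · subst hw
    have h0 := hψ.hasDerivAt 0
    rw [hψ.deriv_zero, hasDerivAt_iff_isLittleO_nhds_zero] at h0
    rw [hasFDerivAt_iff_isLittleO_nhds_zero]
    have hn : Tendsto (fun w : F => ‖w‖) (𝓝 0) (𝓝 0) := tendsto_norm_zero
    have := (h0.comp_tendsto hn).of_norm_right
    simpa [Function.comp_def] using this
  · have h1 := (hψ.hasDerivAt ‖w‖).comp_hasFDerivAt w
      (hasStrictFDerivAt_norm_sq w |>.hasFDerivAt.sqrt (by simpa using hw) |>.congr_of_eventuallyEq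
        (f₁ := fun w : F => ‖w‖) (Eventually.of_forall fun w => by simp))
    refine h1.congr_fderiv ?_
    have hw' : ‖w‖ ≠ 0 := norm_ne_zero_iff.2 hw
    ext x
    simp [hψ.deriv_eq]
    field_simp

theorem comp_norm_le (w w' : F) :
    ψ ‖w'‖ ≤ ψ ‖w‖ + weight ψ ‖w‖ * inner ℝ w (w' - w)
      + 1 / 2 * (weight ψ ‖w‖ * ‖w' - w‖ ^ 2) := by
  have h := hψ.le_quadratic (norm_nonneg w) (norm_nonneg w')
  have h2 : ‖w'‖ ^ 2 = ‖w‖ ^ 2 + 2 * inner ℝ w (w' - w) + ‖w' - w‖ ^ 2 := by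
    rw [← norm_add_sq_real]; simp
  rw [h2] at h
  linarith

/-- Tangent inequality for `ψ` at `‖w‖`, combined with `⟨w, w' - w⟩ ≤ ‖w‖(‖w'‖ - ‖w‖)`; the
nonnegative weight preserves the direction. -/
theorem le_comp_norm_of_convexOn (hc : ConvexOn ℝ univ ψ) (w w' : F) :
    ψ ‖w‖ + weight ψ ‖w‖ * inner ℝ w (w' - w) ≤ ψ ‖w'‖ := by
  have h := tangent_le_of_convexOn hc (mem_univ ‖w‖) (mem_univ ‖w'‖) (hψ.hasDerivAt ‖w‖)
  rw [hψ.deriv_eq, mul_assoc] at h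
  refine le_trans ?_ h
  gcongr
  · exact hψ.weight_nonneg _ (norm_nonneg _)
  · rw [inner_sub_right, real_inner_self_eq_norm_sq]
    nlinarith [real_inner_le_norm w w']

end IsPotential

/-! ### Penalties -/

section Penalty

variable {ι : Type*} [Fintype ι] {E : Type*} [NormedAddCommGroup E] [InnerProductSpace ℝ E]
  [CompleteSpace E] {F : ι → Type*} [∀ s, NormedAddCommGroup (F s)]
  [∀ s, InnerProductSpace ℝ (F s)] [∀ s, CompleteSpace (F s)]
  (ψ : ι → ℝ → ℝ) (L : ∀ s, E →L[ℝ] F s) (v : ∀ s, F s)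

/-- The penalty `∑ₛ ψₛ(‖Lₛ h - vₛ‖)`. -/
noncomputable def penalty (h : E) : ℝ := ∑ s, ψ s ‖L s h - v s‖

/-- The operator `∑ₛ νₛ(‖Lₛ h - vₛ‖) Lₛ* Lₛ`. -/
noncomputable def penaltyOp (h : E) : E →L[ℝ] E :=
  ∑ s, weight (ψ s) ‖L s h - v s‖ • (L s).adjoint ∘L L s

/-- The vector `∑ₛ νₛ(‖Lₛ h - vₛ‖) Lₛ* vₛ`. -/
noncomputable def penaltyVec (h : E) : E :=
  ∑ s, weight (ψ s) ‖L s h - v s‖ • (L s).adjoint (v s)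

variable {ψ L v}

theorem inner_penaltyOp (h x z : E) : inner ℝ x (penaltyOp ψ L v h z)
    = ∑ s, weight (ψ s) ‖L s h - v s‖ * inner ℝ (L s x) (L s z) := by
  simp [penaltyOp, inner_sum, inner_smul_right,
    ContinuousLinearMap.adjoint_inner_right]

theorem inner_penalty_gradient (h x : E) :
    inner ℝ (penaltyOp ψ L v h h - penaltyVec ψ L v h) x
      = ∑ s, weight (ψ s) ‖L s h - v s‖ * inner ℝ (L s h - v s) (L s x) := by
  rw [real_inner_comm, inner_sub_right, inner_penaltyOp]
  simp only [penaltyVec, inner_sum, inner_smul_right, ContinuousLinearMap.adjoint_inner_right,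
    ← Finset.sum_sub_distrib, ← mul_sub, ← inner_sub_right]
  simp only [real_inner_comm]

variable (hψ : ∀ s, IsPotential (ψ s))
include hψ

theorem hasGradientAt_penalty (h : E) :
    HasGradientAt (penalty ψ L v) (penaltyOp ψ L v h h - penaltyVec ψ L v h) h := by
  rw [hasGradientAt_iff_hasFDerivAt]
  have : HasFDerivAt (penalty ψ L v) (∑ s, (weight (ψ s) ‖L s h - v s‖ •
      innerSL ℝ (L s h - v s)).comp (L s)) h := by
    refine HasFDerivAt.fun_sum fun s _ => ?_
    exact ((hψ s).hasFDerivAt_comp_norm _).comp h ((L s).hasFDerivAt.sub_const _)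
  refine this.congr_fderiv ?_
  ext x
  rw [InnerProductSpace.toDual_apply_apply, inner_penalty_gradient]
  simp [inner_sub_left]

theorem penalty_le (h h' : E) : penalty ψ L v h' ≤ penalty ψ L v h
    + inner ℝ (penaltyOp ψ L v h h - penaltyVec ψ L v h) (h' - h)
    + 1 / 2 * inner ℝ (h' - h) (penaltyOp ψ L v h (h' - h)) := by
  rw [inner_penalty_gradient, inner_penaltyOp, Finset.mul_sum, penalty, penalty,
    ← Finset.sum_add_distrib, ← Finset.sum_add_distrib]
  refine Finset.sum_le_sum fun s _ => ?_
  have := (hψ s).comp_norm_le (L s h - v s) (L s h' - v s)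
  rwa [sub_sub_sub_cancel_right, ← map_sub, ← real_inner_self_eq_norm_sq] at this

theorem le_penalty_of_convexOn (hc : ∀ s, ConvexOn ℝ univ (ψ s)) (h h' : E) :
    penalty ψ L v h + inner ℝ (penaltyOp ψ L v h h - penaltyVec ψ L v h) (h' - h)
      ≤ penalty ψ L v h' := by
  rw [inner_penalty_gradient, penalty, penalty, ← Finset.sum_add_distrib]
  refine Finset.sum_le_sum fun s _ => ?_
  have := (hψ s).le_comp_norm_of_convexOn (hc s) (L s h - v s) (L s h' - v s)
  rwa [sub_sub_sub_cancel_right, ← map_sub] at this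

omit [CompleteSpace E] [∀ s, CompleteSpace (F s)] in
theorem continuous_penalty : Continuous (penalty ψ L v) := by
  have := fun s => (hψ s).contDiff.continuous
  unfold penalty
  fun_prop

theorem continuous_penaltyOp : Continuous (penaltyOp ψ L v) := by
  have := fun s => (hψ s).continuous_weight
  unfold penaltyOp
  fun_prop

theorem continuous_penaltyVec : Continuous (penaltyVec ψ L v) := by
  have := fun s => (hψ s).continuous_weight
  unfold penaltyVec
  fun_prop

theorem inner_penaltyOp_nonneg (h x : E) : 0 ≤ inner ℝ x (penaltyOp ψ L v h x) := by
  rw [inner_penaltyOp]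
  exact Finset.sum_nonneg fun s _ => mul_nonneg ((hψ s).weight_nonneg _ (norm_nonneg _))
    real_inner_self_nonneg

variable {C : ℝ} (hC : ∀ s t, 0 ≤ t → weight (ψ s) t ≤ C)
include hC

theorem norm_penaltyVec_le (h : E) :
    ‖penaltyVec ψ L v h‖ ≤ ∑ s, C * ‖(L s).adjoint (v s)‖ := by
  refine norm_sum_le_of_le _ fun s _ => ?_
  rw [norm_smul, Real.norm_of_nonneg ((hψ s).weight_nonneg _ (norm_nonneg _))]
  gcongr
  exact hC s _ (norm_nonneg _)

theorem norm_penaltyOp_le (h : E) :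
    ‖penaltyOp ψ L v h‖ ≤ ∑ s, C * ‖(L s).adjoint ∘L L s‖ := by
  refine norm_sum_le_of_le _ fun s _ => ?_
  rw [norm_smul, Real.norm_of_nonneg ((hψ s).weight_nonneg _ (norm_nonneg _))]
  gcongr
  exact hC s _ (norm_nonneg _)

end Penalty

end OnlineMM

/-! ### Cluster points of bounded sequences with vanishing increments -/

namespace OnlineMM

section ClusterPoints

theorem isClosed_clusterPoints {E : Type*} [TopologicalSpace E] (u : ℕ → E) :
    IsClosed (clusterPoints u) :=
  isClosed_setOfPred_clusterPt

variable {E : Type*} [PseudoMetricSpace E] [ProperSpace E] {u : ℕ → E}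

theorem nonempty_clusterPoints (hu : Bornology.IsBounded (range u)) :
    (clusterPoints u).Nonempty := by
  obtain ⟨z, -, hz⟩ := hu.isCompact_closure.exists_mapClusterPt (f := atTop) (u := u)
    (tendsto_principal.2 (Eventually.of_forall fun n => subset_closure (mem_range_self n)))
  exact ⟨z, hz⟩

omit [ProperSpace E] in
theorem clusterPoints_subset (u : ℕ → E) : clusterPoints u ⊆ closure (range u) := by
  intro z hz
  rw [mem_closure_iff_clusterPt]
  exact ClusterPt.mono hz (le_principal_iff.2 range_mem_map)

theorem isCompact_clusterPoints (hu : Bornology.IsBounded (range u)) :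
    IsCompact (clusterPoints u) :=
  hu.isCompact_closure.of_isClosed_subset (isClosed_clusterPoints u) (clusterPoints_subset u)

/-- If a real sequence with small increments is frequently small and frequently large, then it is
frequently in between. -/
theorem frequently_mem_Icc_of_increments {s : ℕ → ℝ} {a b : ℝ}
    (hs : ∀ᶠ n in atTop, |s (n + 1) - s n| ≤ b - a)
    (ha : ∃ᶠ n in atTop, s n < a) (hb : ∃ᶠ n in atTop, b < s n) :
    ∃ᶠ n in atTop, s n ∈ Icc a b := by
  rw [frequently_atTop] at *
  obtain ⟨n₀, hn₀⟩ := eventually_atTop.1 hs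
  have hab : a ≤ b := by linarith [abs_nonneg (s (n₀ + 1) - s n₀), hn₀ n₀ le_rfl]
  intro n₁
  obtain ⟨n, hn, hsn⟩ := ha (max n₀ n₁)
  obtain ⟨m, hm, hsm⟩ := hb n
  classical
  -- At the first index after `n` where `s` reaches `a`, the previous value is below `a`, so one
  -- increment cannot pass `b`.
  have hex : ∃ k, a ≤ s (n + k) := ⟨m - n, by rw [Nat.add_sub_cancel' hm]; linarith⟩
  have hk := Nat.find_spec hex
  have hk0 : Nat.find hex ≠ 0 := by
    intro h0
    rw [h0] at hk
    simp only [add_zero] at hk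
    linarith
  obtain ⟨j, hj⟩ := Nat.exists_eq_succ_of_ne_zero hk0
  have hlt : s (n + j) < a := not_le.1 (Nat.find_min hex (by omega))
  rw [hj] at hk
  have hinc := (abs_le.1 (hn₀ (n + j) (by omega))).2
  refine ⟨n + j.succ, by omega, hk, ?_⟩
  have : n + j.succ = n + j + 1 := rfl
  rw [this]
  linarith

/-- The set of cluster points of a bounded sequence with vanishing increments is connected. -/
theorem isPreconnected_clusterPoints (hu : Bornology.IsBounded (range u))
    (hd : Tendsto (fun n => dist (u (n + 1)) (u n)) atTop (𝓝 0)) :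
    IsPreconnected (clusterPoints u) := by
  rw [isPreconnected_closed_iff]
  intro t t' ht ht' hsub hne hne'
  by_contra hcon
  rw [not_nonempty_iff_eq_empty] at hcon
  have hC := isCompact_clusterPoints hu
  set A := clusterPoints u ∩ t
  set B := clusterPoints u ∩ t'
  have hA : IsCompact A := hC.inter_right ht
  have hB : IsCompact B := hC.inter_right ht'
  have hdisj : Disjoint A B := by
    rw [Set.disjoint_left]
    rintro x ⟨hx, hxt⟩ ⟨-, hxt'⟩
    exact (hcon ▸ (⟨hx, hxt, hxt'⟩ : x ∈ clusterPoints u ∩ (t ∩ t')) : x ∈ (∅ : Set E))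
  -- Two disjoint compact pieces `A` and `B` of the cluster set are a positive distance apart.
  have hfB : ∃ δ, 0 < δ ∧ ∀ x ∈ B, δ ≤ Metric.infDist x A := by
    obtain ⟨x, hx, hmin⟩ := hB.exists_isMinOn hne' (Metric.continuous_infDist_pt A).continuousOn
    refine ⟨Metric.infDist x A, ?_, fun y hy => hmin hy⟩
    refine lt_of_le_of_ne Metric.infDist_nonneg fun h0 => ?_
    have := ((isClosed_clusterPoints u).inter ht).mem_iff_infDist_zero hne |>.2 h0.symm
    exact Set.disjoint_left.1 hdisj this hx
  obtain ⟨δ, hδ, hδB⟩ := hfB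
  have hcont := Metric.continuous_infDist_pt A
  have freq : ∀ z ∈ clusterPoints u, ∀ U : Set ℝ, IsOpen U → Metric.infDist z A ∈ U →
      ∃ᶠ n in atTop, Metric.infDist (u n) A ∈ U := fun z hz U hU hzU =>
    mapClusterPt_iff_frequently.1 hz _ ((hU.preimage hcont).mem_nhds hzU)
  obtain ⟨a, ha⟩ := hne
  obtain ⟨b, hb⟩ := hne'
  have h1 : ∃ᶠ n in atTop, Metric.infDist (u n) A < δ / 3 :=
    freq a ha.1 (Iio (δ / 3)) isOpen_Iio (by
      rw [Metric.infDist_zero_of_mem ha]; exact mem_Iio.2 (by positivity))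
  have h2 : ∃ᶠ n in atTop, 2 * δ / 3 < Metric.infDist (u n) A :=
    freq b hb.1 (Ioi (2 * δ / 3)) isOpen_Ioi (by
      have := hδB b hb; exact mem_Ioi.2 (by linarith))
  have hinc : ∀ᶠ n in atTop,
      |Metric.infDist (u (n + 1)) A - Metric.infDist (u n) A| ≤ 2 * δ / 3 - δ / 3 := by
    filter_upwards [hd.eventually (gt_mem_nhds (show (0 : ℝ) < 2 * δ / 3 - δ / 3 by linarith))]
      with n hn
    have := (Metric.lipschitz_infDist_pt A).dist_le_mul (u (n + 1)) (u n)
    rw [Real.dist_eq] at this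
    simp only [NNReal.coe_one, one_mul] at this
    linarith
  -- Travelling between neighbourhoods of `A` and `B` by small steps, the sequence is frequently in
  -- a compact band that misses both; it must have a cluster point there.
  have h3 := frequently_mem_Icc_of_increments hinc h1 h2
  have hcomp : IsCompact (closure (range u) ∩ (fun x => Metric.infDist x A) ⁻¹'
      Icc (δ / 3) (2 * δ / 3)) := hu.isCompact_closure.inter_right (isClosed_Icc.preimage hcont)
  obtain ⟨z, hzm, hz⟩ := hcomp.exists_mapClusterPt_of_frequently (l := atTop) (f := u)
    (h3.mono fun n hn => ⟨subset_closure (mem_range_self n), hn⟩)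
  have hzI : Metric.infDist z A ∈ Icc (δ / 3) (2 * δ / 3) := hzm.2
  rcases hsub hz with hzt | hzt
  · have : Metric.infDist z A = 0 := Metric.infDist_zero_of_mem ⟨hz, hzt⟩
    linarith [hzI.1]
  · linarith [hzI.2, hδB z ⟨hz, hzt⟩]

end ClusterPoints

/-! ### The subspace algorithm along one trajectory -/

section Trajectory

variable {E : Type*} [NormedAddCommGroup E] [InnerProductSpace ℝ E]

/-- A function `Φ` with the tangent quadratic majorants of curvature `P h` and gradient
`P h h - p h` at `h`. -/
structure IsQuadraticallyMajorized (Φ : E → ℝ) (P : E → E →L[ℝ] E) (p : E → E) : Prop where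
  nonneg : ∀ h x, 0 ≤ inner ℝ x (P h x)
  le : ∀ h h', Φ h' ≤ Φ h + inner ℝ (P h h - p h) (h' - h) + 1 / 2 * inner ℝ (h' - h) (P h (h' - h))
  continuous : Continuous Φ
  continuous_op : Continuous P
  continuous_vec : Continuous p
  bounded_op : ∃ C, ∀ h, ‖P h‖ ≤ C
  bounded_vec : ∃ C, ∀ h, ‖p h‖ ≤ C

/-- A sequence generated by the majorize-minimize subspace algorithm for the costs
`½⟨x, Bₙ x⟩ - ⟨cₙ, x⟩ + Φ x`. -/
structure IsSubspaceDescent (P : E → E →L[ℝ] E) (p : E → E) (B : ℕ → E →L[ℝ] E) (c : ℕ → E)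
    (W : ℕ → Submodule ℝ E) (h : ℕ → E) : Prop where
  symm : ∀ n x z, inner ℝ (B n x) z = inner ℝ x (B n z)
  mem : ∀ n, h n ∈ W n
  mem_succ : ∀ n, h (n + 1) ∈ W n
  gradient_mem : ∀ n, B n (h n) - c n + (P (h n) (h n) - p (h n)) ∈ W n
  orthogonal : ∀ n, ∀ w ∈ W n,
    inner ℝ (B n (h (n + 1)) - c n + (P (h n) (h (n + 1)) - p (h n))) w = 0

theorem quadratic_expansion {B : E →L[ℝ] E} (hB : ∀ x z, inner ℝ (B x) z = inner ℝ x (B z))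
    (c x z : E) : 1 / 2 * inner ℝ z (B z) - inner ℝ c z
      = 1 / 2 * inner ℝ x (B x) - inner ℝ c x + inner ℝ (B x - c) (z - x)
        + 1 / 2 * inner ℝ (z - x) (B (z - x)) := by
  have h1 : inner ℝ x (B z) = inner ℝ z (B x) := by rw [← hB, real_inner_comm]
  simp only [inner_sub_left, inner_sub_right, map_sub, hB]
  linarith

/-- A critical point of a strongly convex cost is its only minimizer. -/
theorem lt_of_critical {Φ : E → ℝ} {g : E} {B : E →L[ℝ] E} {c z : E} {α : ℝ} (hα : 0 < α)
    (hB : ∀ x z, inner ℝ (B x) z = inner ℝ x (B z)) (hpos : ∀ x, α * ‖x‖ ^ 2 ≤ inner ℝ x (B x))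
    (hΦ : ∀ z', Φ z + inner ℝ g (z' - z) ≤ Φ z') (hz : B z - c + g = 0) {z' : E}
    (hne : z' ≠ z) : 1 / 2 * inner ℝ z (B z) - inner ℝ c z + Φ z
      < 1 / 2 * inner ℝ z' (B z') - inner ℝ c z' + Φ z' := by
  have h1 := quadratic_expansion hB c z z'
  have h2 : inner ℝ (B z - c) (z' - z) + inner ℝ g (z' - z) = 0 := by
    rw [← inner_add_left, hz, inner_zero_left]
  have h3 : 0 < α * ‖z' - z‖ ^ 2 := by
    have : 0 < ‖z' - z‖ := norm_pos_iff.2 (sub_ne_zero.2 hne)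
    positivity
  linarith [hpos (z' - z), hΦ z']

/-- A perturbation of operator norm below `α / 2` costs at most half of the coercivity. -/
theorem eventually_coercive {B : ℕ → E →L[ℝ] E} {B' : E →L[ℝ] E} {α : ℝ} (hα : 0 < α)
    (hB : Tendsto B atTop (𝓝 B')) (hpos : ∀ x, α * ‖x‖ ^ 2 ≤ inner ℝ x (B' x)) :
    ∀ᶠ n in atTop, ∀ x, α / 2 * ‖x‖ ^ 2 ≤ inner ℝ x (B n x) := by
  have h0 : Tendsto (fun n => ‖B n - B'‖) atTop (𝓝 0) :=
    tendsto_iff_norm_sub_tendsto_zero.1 hB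
  filter_upwards [h0.eventually (gt_mem_nhds (half_pos hα))] with n hn x
  have h1 : -inner ℝ x ((B n - B') x) ≤ ‖x‖ * (‖B n - B'‖ * ‖x‖) := by
    refine (neg_le_abs _).trans ((abs_real_inner_le_norm _ _).trans ?_)
    gcongr
    exact (B n - B').le_opNorm x
  have h2 : ‖x‖ * (‖B n - B'‖ * ‖x‖) ≤ α / 2 * ‖x‖ ^ 2 := by
    nlinarith [sq_nonneg ‖x‖]
  have h3 : inner ℝ x ((B n - B') x) = inner ℝ x (B n x) - inner ℝ x (B' x) := by
    rw [sub_apply, inner_sub_right]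
  linarith [hpos x]

variable {Φ : E → ℝ} {P : E → E →L[ℝ] E} {p : E → E} {B : ℕ → E →L[ℝ] E} {c : ℕ → E}
  {W : ℕ → Submodule ℝ E} {h : ℕ → E}

namespace IsSubspaceDescent

/-- Testing the normal equations with `h (n + 1)` and dropping the nonnegative `P` term bounds it by
`c n + p (h n)`. This bound is uniform in `h n`, so errors do not accumulate. -/
theorem isBounded_range (hΦ : IsQuadraticallyMajorized Φ P p) (hh : IsSubspaceDescent P p B c W h)
    {B' : E →L[ℝ] E} {c' : E} {α : ℝ} (hα : 0 < α) (hB : Tendsto B atTop (𝓝 B'))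
    (hpos : ∀ x, α * ‖x‖ ^ 2 ≤ inner ℝ x (B' x)) (hc : Tendsto c atTop (𝓝 c')) :
    ∃ K, ∀ n, ‖h n‖ ≤ K := by
  obtain ⟨Cp, hCp⟩ := hΦ.bounded_vec
  obtain ⟨Cc, hCc⟩ := hc.norm.bddAbove_range
  have hev : ∀ᶠ n in atTop, ‖h (n + 1)‖ ≤ 2 / α * (Cc + Cp) := by
    filter_upwards [eventually_coercive hα hB hpos] with n hn
    have h1 := hh.orthogonal n _ (hh.mem_succ n)
    have h2 : inner ℝ (c n + p (h n)) (h (n + 1)) ≤ (Cc + Cp) * ‖h (n + 1)‖ := by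
      refine (real_inner_le_norm _ _).trans ?_
      gcongr
      exact (norm_add_le _ _).trans (add_le_add (hCc (mem_range_self n)) (hCp _))
    have h3 := hn (h (n + 1))
    have h4 := hΦ.nonneg (h n) (h (n + 1))
    have h5 : α / 2 * ‖h (n + 1)‖ ^ 2 ≤ (Cc + Cp) * ‖h (n + 1)‖ := by
      simp only [inner_add_left, inner_sub_left] at h1 h2
      rw [real_inner_comm] at h3 h4
      linarith
    rcases (norm_nonneg (h (n + 1))).eq_or_lt with h0 | h0
    · rw [← h0]
      have : 0 ≤ Cc := (norm_nonneg _).trans (hCc (mem_range_self 0))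
      have : 0 ≤ Cp := (norm_nonneg _).trans (hCp 0)
      positivity
    · have : α / 2 * ‖h (n + 1)‖ ≤ Cc + Cp := by
        refine le_of_mul_le_mul_right ?_ h0
        nlinarith
      calc ‖h (n + 1)‖ = 2 / α * (α / 2 * ‖h (n + 1)‖) := by field_simp
        _ ≤ _ := by gcongr
  obtain ⟨K, hK⟩ := (isBoundedUnder_of_eventually_le hev).bddAbove_range
  refine ⟨max K ‖h 0‖, fun n => ?_⟩
  cases n with
  | zero => exact le_max_right _ _
  | succ n => exact (hK (mem_range_self n)).trans (le_max_left _ _)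

/-- The test vector is the increment, which lies in `W n` because both iterates do. -/
theorem descent (hΦ : IsQuadraticallyMajorized Φ P p) (hh : IsSubspaceDescent P p B c W h)
    (n : ℕ) :
    1 / 2 * inner ℝ (h (n + 1)) (B n (h (n + 1))) - inner ℝ (c n) (h (n + 1)) + Φ (h (n + 1))
      + 1 / 2 * inner ℝ (h (n + 1) - h n) (B n (h (n + 1) - h n))
      ≤ 1 / 2 * inner ℝ (h n) (B n (h n)) - inner ℝ (c n) (h n) + Φ (h n) := by
  have h1 := quadratic_expansion (hh.symm n) (c n) (h n) (h (n + 1))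
  have h2 := hΦ.le (h n) (h (n + 1))
  have h3 := hh.orthogonal n _ ((W n).sub_mem (hh.mem_succ n) (hh.mem n))
  have h4 := hΦ.nonneg (h n) (h (n + 1) - h n)
  have e : B n (h (n + 1)) - c n + (P (h n) (h (n + 1)) - p (h n))
      = (B n (h n) - c n) + (P (h n) (h n) - p (h n))
        + (B n (h (n + 1) - h n) + P (h n) (h (n + 1) - h n)) := by
    simp only [map_sub]; abel
  rw [e, inner_add_left, inner_add_left, inner_add_left,
    real_inner_comm (h (n + 1) - h n) (B n (h (n + 1) - h n)),
    real_inner_comm (h (n + 1) - h n) (P (h n) (h (n + 1) - h n))] at h3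
  linarith

/-- The test vector is the gradient `g` itself: `‖g‖² = -⟨(B n + P (h n)) δ, g⟩` with `δ` the
increment. -/
theorem norm_gradient_le (hh : IsSubspaceDescent P p B c W h) (n : ℕ) :
    ‖B n (h n) - c n + (P (h n) (h n) - p (h n))‖
      ≤ (‖B n‖ + ‖P (h n)‖) * ‖h (n + 1) - h n‖ := by
  set g := B n (h n) - c n + (P (h n) (h n) - p (h n)) with hg
  have h3 := hh.orthogonal n _ (hh.gradient_mem n)
  have e : B n (h (n + 1)) - c n + (P (h n) (h (n + 1)) - p (h n))
      = g + (B n + P (h n)) (h (n + 1) - h n) := by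
    simp only [hg, map_sub, add_apply]; abel
  rw [e, inner_add_left, ← hg, real_inner_self_eq_norm_sq] at h3
  have h4 : -inner ℝ ((B n + P (h n)) (h (n + 1) - h n)) g
      ≤ ((‖B n‖ + ‖P (h n)‖) * ‖h (n + 1) - h n‖) * ‖g‖ := by
    refine (neg_le_abs _).trans ((abs_real_inner_le_norm _ _).trans ?_)
    gcongr
    refine ((B n + P (h n)).le_opNorm _).trans ?_
    gcongr
    exact norm_add_le _ _
  rcases (norm_nonneg g).eq_or_lt with h0 | h0
  · rw [← h0]; positivity
  · refine le_of_mul_le_mul_right ?_ h0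
    nlinarith

theorem tendsto_increments [ProperSpace E] (hΦ : IsQuadraticallyMajorized Φ P p)
    (hh : IsSubspaceDescent P p B c W h)
    {B' : E →L[ℝ] E} {c' : E} {α : ℝ} (hα : 0 < α) (hB : Tendsto B atTop (𝓝 B'))
    (hpos : ∀ x, α * ‖x‖ ^ 2 ≤ inner ℝ x (B' x)) (hc : Tendsto c atTop (𝓝 c'))
    (hsum : ∃ K, ∀ m, |∑ n ∈ Finset.range m,
      (1 / 2 * inner ℝ (h (n + 1)) ((B (n + 1) - B n) (h (n + 1)))
        - inner ℝ (c (n + 1) - c n) (h (n + 1)))| ≤ K) :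
    Tendsto (fun n => ‖h (n + 1) - h n‖) atTop (𝓝 0) := by
  obtain ⟨K, hK⟩ := hh.isBounded_range hΦ hα hB hpos hc
  obtain ⟨Cc, hCc⟩ := hc.norm.bddAbove_range
  obtain ⟨Ke, hKe⟩ := hsum
  obtain ⟨CΦ, hCΦ⟩ := (isCompact_closedBall (0 : E) K).exists_bound_of_continuousOn
    hΦ.continuous.continuousOn
  obtain ⟨n₀, hn₀⟩ := eventually_atTop.1 (eventually_coercive hα hB hpos)
  set G : ℕ → ℝ := fun n => 1 / 2 * inner ℝ (h n) (B n (h n)) - inner ℝ (c n) (h n) + Φ (h n)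
    with hG
  set e : ℕ → ℝ := fun n => 1 / 2 * inner ℝ (h (n + 1)) ((B (n + 1) - B n) (h (n + 1)))
        - inner ℝ (c (n + 1) - c n) (h (n + 1)) with he
  -- `e n` is the effect of changing the cost from `n` to `n + 1` at the fixed point `h (n + 1)`; `α
  -- / 4` is half of the eventual coercivity constant.
  have step : ∀ n, n₀ ≤ n → α / 4 * ‖h (n + 1) - h n‖ ^ 2 ≤ G n - G (n + 1) + e n := by
    intro n hn
    have h1 := hh.descent hΦ n
    have h2 := hn₀ n hn (h (n + 1) - h n)
    simp only [hG, he, sub_apply, inner_sub_right, inner_sub_left] at h1 h2 ⊢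
    linarith
  have low : ∀ n, n₀ ≤ n → -(Cc * K + CΦ) ≤ G n := by
    intro n hn
    have h1 : 0 ≤ inner ℝ (h n) (B n (h n)) := le_trans (by positivity) (hn₀ n hn (h n))
    have h2 : inner ℝ (c n) (h n) ≤ Cc * K := by
      refine (real_inner_le_norm _ _).trans ?_
      gcongr
      · exact (norm_nonneg _).trans (hCc (mem_range_self 0))
      · exact hCc (mem_range_self n)
      · exact hK n
    have h3 := hCΦ (h n) (by simpa using hK n)
    have h4 := neg_le_of_abs_le h3
    simp only [hG]
    linarith
  -- Telescoping from `n₀` leaves a difference of two partial sums of `e`, hence `2 * Ke`; absolute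
  -- summability is not needed.
  have bound : ∀ m, ∑ n ∈ Finset.range m, α / 4 * ‖h (n + n₀ + 1) - h (n + n₀)‖ ^ 2
      ≤ G n₀ + (Cc * K + CΦ) + 2 * Ke := by
    intro m
    have h1 : ∑ n ∈ Finset.range m, α / 4 * ‖h (n + n₀ + 1) - h (n + n₀)‖ ^ 2
        ≤ G n₀ - G (m + n₀) + (∑ n ∈ Finset.range (m + n₀), e n - ∑ n ∈ Finset.range n₀, e n) := by
      induction m with
      | zero => simp
      | succ m ih =>
        rw [Finset.sum_range_succ, show m + 1 + n₀ = m + n₀ + 1 by ring,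
          Finset.sum_range_succ]
        linarith [step (m + n₀) (by omega)]
    have h2 := low (m + n₀) (by omega)
    have h3 := abs_le.1 (hKe (m + n₀))
    have h4 := abs_le.1 (hKe n₀)
    linarith
  have hs : Summable fun n => α / 4 * ‖h (n + n₀ + 1) - h (n + n₀)‖ ^ 2 :=
    summable_of_sum_range_le (fun n => by positivity) bound
  have ht := (hs.tendsto_atTop_zero.const_mul (4 / α)).sqrt
  rw [← tendsto_add_atTop_iff_nat n₀]
  simpa [← mul_assoc, hα.ne'] using ht

theorem clusterPoints_properties [ProperSpace E] (hΦ : IsQuadraticallyMajorized Φ P p)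
    (hh : IsSubspaceDescent P p B c W h)
    {B' : E →L[ℝ] E} {c' : E} {α : ℝ} (hα : 0 < α) (hB : Tendsto B atTop (𝓝 B'))
    (hpos : ∀ x, α * ‖x‖ ^ 2 ≤ inner ℝ x (B' x)) (hc : Tendsto c atTop (𝓝 c'))
    (hsum : ∃ K, ∀ m, |∑ n ∈ Finset.range m,
      (1 / 2 * inner ℝ (h (n + 1)) ((B (n + 1) - B n) (h (n + 1)))
        - inner ℝ (c (n + 1) - c n) (h (n + 1)))| ≤ K) :
    (clusterPoints h).Nonempty ∧ IsCompact (clusterPoints h) ∧ IsConnected (clusterPoints h) ∧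
      ∀ z ∈ clusterPoints h, B' z - c' + (P z z - p z) = 0 := by
  obtain ⟨K, hK⟩ := hh.isBounded_range hΦ hα hB hpos hc
  have hinc := hh.tendsto_increments hΦ hα hB hpos hc hsum
  have hb : Bornology.IsBounded (range h) :=
    isBounded_iff_forall_norm_le.2 ⟨K, by rintro _ ⟨n, rfl⟩; exact hK n⟩
  have hne := nonempty_clusterPoints hb
  refine ⟨hne, isCompact_clusterPoints hb, ⟨hne, isPreconnected_clusterPoints hb ?_⟩, ?_⟩
  · simpa only [dist_eq_norm] using hinc
  · intro z hz
    -- An ultrafilter along which `h` tends to `z` plays the role of a subsequence.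
    obtain ⟨U, hU, hUz⟩ := mapClusterPt_iff_ultrafilter.1 hz
    obtain ⟨CP, hCP⟩ := hΦ.bounded_op
    obtain ⟨CB, hCB⟩ := hB.norm.bddAbove_range
    have hg : Tendsto (fun n => B n (h n) - c n + (P (h n) (h n) - p (h n))) atTop (𝓝 0) := by
      refine squeeze_zero_norm (a := fun n => (CB + CP) * ‖h (n + 1) - h n‖) (fun n => ?_)
        (by simpa using hinc.const_mul (CB + CP))
      refine (hh.norm_gradient_le n).trans ?_
      gcongr
      · exact hCB (mem_range_self n)
      · exact hCP _
    have happ : Continuous fun q : (E →L[ℝ] E) × E => q.1 q.2 :=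
      continuous_fst.clm_apply continuous_snd
    have hlim : Tendsto (fun n => B n (h n) - c n + (P (h n) (h n) - p (h n))) U
        (𝓝 (B' z - c' + (P z z - p z))) :=
      (((happ.tendsto (B', z)).comp ((hB.mono_left hU).prodMk_nhds hUz)).sub (hc.mono_left hU)).add
        (((happ.tendsto (P z, z)).comp (((hΦ.continuous_op.tendsto z).comp hUz).prodMk_nhds hUz)).sub
          ((hΦ.continuous_vec.tendsto z).comp hUz))
    exact tendsto_nhds_unique hlim (hg.mono_left hU)

end IsSubspaceDescent

end Trajectory

end OnlineMM

/-! ### Square-integrable martingale differences -/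

namespace OnlineMM

variable {Ω : Type*} {m0 : MeasurableSpace Ω} {μ : Measure Ω} [IsProbabilityMeasure μ]

/-- A sequence of martingale differences that is bounded in `L²`. -/
structure IsMartingaleDifference (ℱ : Filtration ℕ m0) (μ : Measure Ω) (ξ : ℕ → Ω → ℝ) (C : ℝ) :
    Prop where
  adapted : ∀ n, StronglyMeasurable[ℱ n] (ξ n)
  memLp : ∀ n, MemLp (ξ n) 2 μ
  sq_le : ∀ n, ∫ ω, ξ n ω ^ 2 ∂μ ≤ C
  condExp : ∀ n, μ[ξ (n + 1) | ℱ n] =ᵐ[μ] 0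

/-- `|f| ≤ f² + 1` turns second-moment bounds into the `L¹` bounds required by the martingale
convergence theorem. -/
theorem eLpNorm_one_le_of_integral_sq_le {f : Ω → ℝ} {K : ℝ} (hf : MemLp f 2 μ)
    (hK : ∫ ω, f ω ^ 2 ∂μ ≤ K) : eLpNorm f 1 μ ≤ ENNReal.ofReal (K + 1) := by
  have h1 : Integrable f μ := hf.integrable (by norm_num)
  have h2 : Integrable (fun ω => f ω ^ 2) μ := hf.integrable_sq
  rw [eLpNorm_one_eq_lintegral_enorm, ← ofReal_integral_norm_eq_lintegral_enorm h1]
  refine ENNReal.ofReal_le_ofReal ?_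
  calc ∫ ω, ‖f ω‖ ∂μ ≤ ∫ ω, (f ω ^ 2 + 1) ∂μ := by
        refine integral_mono h1.norm (h2.add (integrable_const 1)) fun ω => ?_
        simp only [Real.norm_eq_abs]
        nlinarith [sq_abs (f ω), sq_nonneg (|f ω| - 1), abs_nonneg (f ω)]
    _ = ∫ ω, f ω ^ 2 ∂μ + 1 := by rw [integral_add h2 (integrable_const 1)]; simp
    _ ≤ K + 1 := by linarith

omit [IsProbabilityMeasure μ] in
/-- A sequence whose `L¹` norms are summable is almost surely absolutely summable. -/
theorem ae_summable_of_summable_integral {f : ℕ → Ω → ℝ} (hf : ∀ n, Integrable (f n) μ)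
    {a : ℕ → ℝ} (ha : Summable a) (hfa : ∀ n, ∫ ω, |f n ω| ∂μ ≤ a n) :
    ∀ᵐ ω ∂μ, Summable fun n => |f n ω| := by
  have hfin : ∑' n, eLpNorm (f n) 1 μ ≠ ⊤ := by
    have hle : ∀ n, eLpNorm (f n) 1 μ ≤ ENNReal.ofReal (a n) := fun n => by
      rw [eLpNorm_one_eq_lintegral_enorm, ← ofReal_integral_norm_eq_lintegral_enorm (hf n)]
      exact ENNReal.ofReal_le_ofReal (hfa n)
    exact ne_top_of_le_ne_top ha.tsum_ofReal_ne_top (ENNReal.tsum_le_tsum hle)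
  filter_upwards [summable_norm_of_tsum_eLpNorm_ne_top le_rfl
    (fun n => (hf n).aestronglyMeasurable) hfin] with ω hω
  simpa using hω

theorem summable_rpow_shift : Summable fun n : ℕ => ((n : ℝ) + 1) ^ (-(3 / 2) : ℝ) := by
  have := (summable_nat_add_iff 1).2 (Real.summable_nat_rpow.2 (show (-(3 / 2) : ℝ) < -1 by norm_num))
  simpa using this

theorem summable_inv_sq_shift : Summable fun n : ℕ => (1 / ((n : ℝ) + 2)) ^ 2 := by
  have := (summable_nat_add_iff 2).2 (Real.summable_one_div_nat_pow.2 (show 1 < 2 by norm_num))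
  simpa using this

namespace IsMartingaleDifference

variable {ℱ : Filtration ℕ m0} {ξ : ℕ → Ω → ℝ} {C : ℝ} (hξ : IsMartingaleDifference ℱ μ ξ C)
include hξ

omit [IsProbabilityMeasure μ] in
theorem const_nonneg : 0 ≤ C :=
  (integral_nonneg fun ω => sq_nonneg (ξ 0 ω)).trans (hξ.sq_le 0)

theorem integral_mul_eq_zero {n : ℕ} {f : Ω → ℝ} (hf : StronglyMeasurable[ℱ n] f)
    (hf2 : MemLp f 2 μ) : ∫ ω, f ω * ξ (n + 1) ω ∂μ = 0 := by
  have hi : Integrable (f * ξ (n + 1)) μ := hf2.integrable_mul (hξ.memLp (n + 1))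
  have h1 := condExp_mul_of_stronglyMeasurable_left hf hi ((hξ.memLp (n + 1)).integrable (by norm_num))
  have h2 : μ[f * ξ (n + 1) | ℱ n] =ᵐ[μ] 0 := by
    filter_upwards [h1, hξ.condExp n] with ω h1 h2
    simp [h1, h2]
  rw [show (fun ω => f ω * ξ (n + 1) ω) = f * ξ (n + 1) from rfl, ← integral_condExp (ℱ.le n),
    integral_congr_ae h2]
  simp

/-- One Pythagorean step of a martingale transform: the cross term is `ξ (n + 1)` against the `ℱ
n`-measurable `w * f`, and integrates to zero. -/
theorem integral_add_mul_sq {n : ℕ} {f w : Ω → ℝ} {K : ℝ} (hf : StronglyMeasurable[ℱ n] f)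
    (hf2 : MemLp f 2 μ) (hw : StronglyMeasurable[ℱ n] w) (hK : ∀ ω, |w ω| ≤ K) :
    MemLp (fun ω => f ω + w ω * ξ (n + 1) ω) 2 μ ∧
    ∫ ω, (f ω + w ω * ξ (n + 1) ω) ^ 2 ∂μ ≤ ∫ ω, f ω ^ 2 ∂μ + K ^ 2 * C := by
  have hbdd : ∀ {g : Ω → ℝ}, MemLp g 2 μ → MemLp (fun ω => w ω * g ω) 2 μ := fun {g} hg =>
    hg.of_le_mul (c := K) ((hw.mono (ℱ.le n)).aestronglyMeasurable.mul hg.1)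
      (Eventually.of_forall fun ω => by
        rw [norm_mul]; exact mul_le_mul_of_nonneg_right (hK ω) (norm_nonneg _))
  have hwξ := hbdd (hξ.memLp (n + 1))
  have hwf := hbdd hf2
  refine ⟨hf2.add hwξ, ?_⟩
  have hcross := hξ.integral_mul_eq_zero (hw.mul hf) hwf
  have hi1 : Integrable (fun ω => f ω ^ 2) μ := hf2.integrable_sq
  have hi2 : Integrable (fun ω => (w * f) ω * ξ (n + 1) ω) μ :=
    hwf.integrable_mul (hξ.memLp (n + 1))
  have hi3 : Integrable (fun ω => (w ω * ξ (n + 1) ω) ^ 2) μ := hwξ.integrable_sq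
  have hi4 : Integrable (fun ω => ξ (n + 1) ω ^ 2) μ := (hξ.memLp (n + 1)).integrable_sq
  have e : ∀ ω, (f ω + w ω * ξ (n + 1) ω) ^ 2
      = f ω ^ 2 + 2 * ((w * f) ω * ξ (n + 1) ω) + (w ω * ξ (n + 1) ω) ^ 2 := by
    intro ω
    simp only [Pi.mul_apply]
    ring
  simp only [e]
  have hi5 : Integrable (fun ω => f ω ^ 2 + 2 * ((w * f) ω * ξ (n + 1) ω)) μ :=
    hi1.add (hi2.const_mul 2)
  rw [integral_add hi5 hi3, integral_add hi1 (hi2.const_mul 2),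
    integral_const_mul, hcross, mul_zero, add_zero]
  gcongr
  calc ∫ ω, (w ω * ξ (n + 1) ω) ^ 2 ∂μ ≤ ∫ ω, K ^ 2 * ξ (n + 1) ω ^ 2 ∂μ := by
        refine integral_mono hi3 (hi4.const_mul _) fun ω => ?_
        simp only [mul_pow]
        gcongr ?_ * _
        rw [← sq_abs]
        have := hK ω
        gcongr
    _ ≤ K ^ 2 * C := by
        rw [integral_const_mul]
        gcongr
        exact hξ.sq_le _

/-- The martingale transform with weights of order `1 / n` converges almost surely. -/
theorem ae_exists_tendsto_of_bounded {a : ℕ → Ω → ℝ} {K : ℝ}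
    (ha : ∀ n, StronglyMeasurable[ℱ n] (a n)) (hK : ∀ n ω, |a n ω| ≤ K) :
    ∀ᵐ ω ∂μ, ∃ l, Tendsto
      (fun m => ∑ n ∈ Finset.range m, a n ω * (ξ (n + 1) ω / ((n : ℝ) + 2))) atTop (𝓝 l) := by
  set w : ℕ → Ω → ℝ := fun n ω => a n ω * (1 / ((n : ℝ) + 2)) with hw
  set T : ℕ → Ω → ℝ := fun m ω => ∑ n ∈ Finset.range m, w n ω * ξ (n + 1) ω with hT
  have hTs : ∀ m, T (m + 1) = fun ω => T m ω + w m ω * ξ (m + 1) ω := fun m => by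
    ext ω; simp only [hT, Finset.sum_range_succ]
  have hwm : ∀ n, StronglyMeasurable[ℱ n] (w n) := fun n => (ha n).mul_const _
  have hwK : ∀ n ω, |w n ω| ≤ K * (1 / ((n : ℝ) + 2)) := fun n ω => by
    simp only [hw]
    rw [abs_mul, abs_of_nonneg (show (0 : ℝ) ≤ 1 / ((n : ℝ) + 2) by positivity)]
    have := hK n ω
    gcongr
  have hadapt : StronglyAdapted ℱ T := by
    intro m
    induction m with
    | zero => simpa [hT] using stronglyMeasurable_const
    | succ m ih =>
      rw [hTs]
      exact (ih.mono (ℱ.mono m.le_succ)).add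
        (((hwm m).mono (ℱ.mono m.le_succ)).mul (hξ.adapted (m + 1)))
  -- Second moments add up along orthogonal increments, and `∑ 1 / (n + 2)²` is finite, so `T` is
  -- bounded in `L²`.
  have hL2 : ∀ m, MemLp (T m) 2 μ ∧
      ∫ ω, T m ω ^ 2 ∂μ ≤ ∑ n ∈ Finset.range m, (1 / ((n : ℝ) + 2)) ^ 2 * (K ^ 2 * C) := by
    intro m
    induction m with
    | zero => simp [hT]
    | succ m ih =>
      rw [hTs, Finset.sum_range_succ]
      have := hξ.integral_add_mul_sq (hadapt m) ih.1 (hwm m) (hwK m)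
      refine ⟨this.1, this.2.trans ?_⟩
      rw [mul_pow]
      linarith [ih.2]
  have hbound : ∀ m, ∫ ω, T m ω ^ 2 ∂μ ≤ ∑' n : ℕ, (1 / ((n : ℝ) + 2)) ^ 2 * (K ^ 2 * C) := by
    intro m
    have hC := hξ.const_nonneg
    exact (hL2 m).2.trans ((summable_inv_sq_shift.mul_right _).sum_le_tsum _
      fun n _ => by positivity)
  have hmart : Martingale T ℱ μ := by
    refine martingale_of_condExp_sub_eq_zero_nat hadapt
      (fun m => (hL2 m).1.integrable (by norm_num)) fun m => ?_
    have e : T (m + 1) - T m = w m * ξ (m + 1) := by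
      rw [hTs]; ext ω; simp
    have hi : Integrable (w m * ξ (m + 1)) μ := by
      rw [← e]
      exact ((hL2 (m + 1)).1.integrable (by norm_num)).sub ((hL2 m).1.integrable (by norm_num))
    rw [e]
    filter_upwards [condExp_mul_of_stronglyMeasurable_left (hwm m) hi
      ((hξ.memLp (m + 1)).integrable (by norm_num)), hξ.condExp m] with ω h1 h2
    simp [h1, h2]
  have hconv := hmart.submartingale.exists_ae_tendsto_of_bdd
    (R := Real.toNNReal (∑' n : ℕ, (1 / ((n : ℝ) + 2)) ^ 2 * (K ^ 2 * C) + 1))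
    fun m => eLpNorm_one_le_of_integral_sq_le (hL2 m).1 (hbound m)
  filter_upwards [hconv] with ω ⟨l, hl⟩
  refine ⟨l, hl.congr fun m => ?_⟩
  simp only [hT, hw]
  exact Finset.sum_congr rfl fun n _ => by ring

/-- The martingale transform with weights `aₙ / n`, where `a` is almost surely bounded,
converges almost surely. -/
theorem ae_exists_tendsto {a : ℕ → Ω → ℝ} (ha : ∀ n, StronglyMeasurable[ℱ n] (a n))
    (hK : ∀ᵐ ω ∂μ, ∃ K, ∀ n, |a n ω| ≤ K) :
    ∀ᵐ ω ∂μ, ∃ l, Tendsto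
      (fun m => ∑ n ∈ Finset.range m, a n ω * (ξ (n + 1) ω / ((n : ℝ) + 2))) atTop (𝓝 l) := by
  -- The bound on `a` depends on `ω`, so `a` is truncated at each integer level. Countably many null
  -- sets are lost, and a level above the bound at `ω` changes nothing there.
  have htrunc : ∀ᵐ ω ∂μ, ∀ K : ℕ, ∃ l, Tendsto (fun m => ∑ n ∈ Finset.range m,
      max (-(K : ℝ)) (min (a n ω) K) * (ξ (n + 1) ω / ((n : ℝ) + 2))) atTop (𝓝 l) := by
    rw [ae_all_iff]
    intro K
    refine hξ.ae_exists_tendsto_of_bounded (a := fun n ω => max (-(K : ℝ)) (min (a n ω) K))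
      (K := K) (fun n => ?_) fun n ω => ?_
    · exact (by fun_prop : Continuous fun x : ℝ => max (-(K : ℝ)) (min x K)).comp_stronglyMeasurable
        (ha n)
    · have : (0 : ℝ) ≤ K := Nat.cast_nonneg K
      exact abs_le.2 ⟨le_max_left _ _, max_le (by linarith) (min_le_right _ _)⟩
  filter_upwards [htrunc, hK] with ω h1 ⟨K, hK⟩
  obtain ⟨k, hk⟩ := exists_nat_ge K
  obtain ⟨l, hl⟩ := h1 k
  refine ⟨l, hl.congr fun m => Finset.sum_congr rfl fun n _ => ?_⟩
  have := abs_le.1 ((hK n).trans hk)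
  rw [min_eq_left this.2, max_eq_right this.1]

theorem memLp_sum (n : ℕ) : StronglyMeasurable[ℱ n] (fun ω => ∑ k ∈ Finset.range (n + 1), ξ k ω) ∧
    MemLp (fun ω => ∑ k ∈ Finset.range (n + 1), ξ k ω) 2 μ ∧
    ∫ ω, (∑ k ∈ Finset.range (n + 1), ξ k ω) ^ 2 ∂μ ≤ ((n : ℝ) + 1) * C := by
  induction n with
  | zero => simpa using ⟨hξ.adapted 0, hξ.memLp 0, hξ.sq_le 0⟩
  | succ n ih =>
    have h := hξ.integral_add_mul_sq (w := fun _ => 1) (K := 1) ih.1 ih.2.1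
      stronglyMeasurable_const (by simp)
    simp only [one_mul, one_pow] at h
    refine ⟨?_, ?_, ?_⟩
    · simp only [Finset.sum_range_succ _ (n + 1)]
      exact (ih.1.mono (ℱ.mono n.le_succ)).add (hξ.adapted (n + 1))
    · simp only [Finset.sum_range_succ _ (n + 1)]
      exact h.1
    · simp only [Finset.sum_range_succ _ (n + 1)]
      refine h.2.trans ?_
      push_cast
      linarith [ih.2.2]

/-- The empirical means of the martingale differences are almost surely summable against
`1 / n`. -/
theorem ae_summable_mean : ∀ᵐ ω ∂μ, Summable fun n : ℕ =>
    |(((n : ℝ) + 1)⁻¹ * ∑ k ∈ Finset.range (n + 1), ξ k ω) / ((n : ℝ) + 2)| := by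
  have hC := hξ.const_nonneg
  refine ae_summable_of_summable_integral
    (fun n => (((hξ.memLp_sum n).2.1.integrable (by norm_num)).const_mul _).div_const _)
    (summable_rpow_shift.mul_right (C + 1)) fun n => ?_
  obtain ⟨-, h2, h3⟩ := hξ.memLp_sum n
  set S : Ω → ℝ := fun ω => ∑ k ∈ Finset.range (n + 1), ξ k ω with hS
  set r : ℝ := (n : ℝ) + 1 with hr
  have hr0 : 0 < r := by positivity
  set q : ℝ := Real.sqrt r with hq
  have hq0 : 0 < q := Real.sqrt_pos.2 hr0
  have hqr : q ^ 2 = r := Real.sq_sqrt hr0.le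
  have hrp : r ^ (-(3 / 2) : ℝ) = (q ^ 3)⁻¹ := by
    rw [Real.rpow_neg hr0.le, hq, Real.sqrt_eq_rpow, ← Real.rpow_natCast, ← Real.rpow_mul hr0.le]
    norm_num
  have hsq : Integrable (fun ω => S ω ^ 2) μ := h2.integrable_sq
  -- From `|S| q ≤ S² + q²` with `q = √(n + 1)`, the typical size of `S`: since `E S² ≤ q² C`, both
  -- terms have expectation `O(q⁻³)`.
  have pt : ∀ ω, |(r⁻¹ * S ω) / ((n : ℝ) + 2)| ≤ (q ^ 5)⁻¹ * S ω ^ 2 + (q ^ 3)⁻¹ := by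
    intro ω
    have h1 : |(r⁻¹ * S ω) / ((n : ℝ) + 2)| ≤ (q ^ 4)⁻¹ * |S ω| := by
      rw [abs_div, abs_mul, abs_of_pos (inv_pos.2 hr0),
        abs_of_pos (show (0 : ℝ) < (n : ℝ) + 2 by positivity), div_le_iff₀ (by positivity)]
      have h4 : (q ^ 4)⁻¹ = r⁻¹ * r⁻¹ := by rw [← hqr, ← mul_inv]; ring
      rw [h4]
      have h5 : 1 ≤ r⁻¹ * ((n : ℝ) + 2) := by
        rw [inv_mul_eq_div, le_div_iff₀ hr0]; linarith
      calc r⁻¹ * |S ω| = (r⁻¹ * |S ω|) * 1 := (mul_one _).symm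
        _ ≤ (r⁻¹ * |S ω|) * (r⁻¹ * ((n : ℝ) + 2)) := by gcongr
        _ = _ := by ring
    have h2 : |S ω| * q ≤ S ω ^ 2 + q ^ 2 := by
      nlinarith [sq_abs (S ω), sq_nonneg (|S ω| - q), abs_nonneg (S ω)]
    calc _ ≤ _ := h1
      _ = (q ^ 5)⁻¹ * (|S ω| * q) := by field_simp
      _ ≤ (q ^ 5)⁻¹ * (S ω ^ 2 + q ^ 2) := by gcongr
      _ = _ := by field_simp
  calc ∫ ω, |(r⁻¹ * S ω) / ((n : ℝ) + 2)| ∂μ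
      ≤ ∫ ω, ((q ^ 5)⁻¹ * S ω ^ 2 + (q ^ 3)⁻¹) ∂μ :=
        integral_mono ((((h2.integrable (by norm_num)).const_mul _).div_const _).abs)
          ((hsq.const_mul _).add (integrable_const _)) pt
    _ = (q ^ 5)⁻¹ * ∫ ω, S ω ^ 2 ∂μ + (q ^ 3)⁻¹ := by
        rw [integral_add (hsq.const_mul _) (integrable_const _), integral_const_mul]; simp
    _ ≤ (q ^ 5)⁻¹ * (q ^ 2 * C) + (q ^ 3)⁻¹ := by rw [hqr]; gcongr
    _ = r ^ (-(3 / 2) : ℝ) * (C + 1) := by rw [hrp]; field_simp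

omit hξ in
-- The fresh term is handled by martingale convergence, the old mean by absolute summability.
theorem mean_increment (x : ℕ → ℝ) (n : ℕ) :
    ((((n + 1 : ℕ) : ℝ) + 1)⁻¹ * ∑ k ∈ Finset.range (n + 1 + 1), x k)
      - ((n : ℝ) + 1)⁻¹ * ∑ k ∈ Finset.range (n + 1), x k
      = x (n + 1) / ((n : ℝ) + 2)
        - (((n : ℝ) + 1)⁻¹ * ∑ k ∈ Finset.range (n + 1), x k) / ((n : ℝ) + 2) := by
  rw [Finset.sum_range_succ _ (n + 1)]
  have h1 : (n : ℝ) + 1 ≠ 0 := by positivity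
  have h2 : (n : ℝ) + 2 ≠ 0 := by positivity
  have h3 : (((n + 1 : ℕ) : ℝ) + 1) = (n : ℝ) + 2 := by push_cast; ring
  rw [h3]
  field_simp
  ring

/-- The increments of the empirical means, weighted by an adapted and almost surely bounded
process, are almost surely summable in the sense of Cauchy. -/
theorem ae_exists_tendsto_increments {a : ℕ → Ω → ℝ} (ha : ∀ n, StronglyMeasurable[ℱ n] (a n))
    (hK : ∀ᵐ ω ∂μ, ∃ K, ∀ n, |a n ω| ≤ K) :
    ∀ᵐ ω ∂μ, ∃ l, Tendsto (fun m => ∑ n ∈ Finset.range m, a n ω *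
      (((((n + 1 : ℕ) : ℝ) + 1)⁻¹ * ∑ k ∈ Finset.range (n + 1 + 1), ξ k ω)
        - ((n : ℝ) + 1)⁻¹ * ∑ k ∈ Finset.range (n + 1), ξ k ω)) atTop (𝓝 l) := by
  filter_upwards [hξ.ae_exists_tendsto ha hK, hξ.ae_summable_mean, hK] with ω ⟨l, hl⟩ hs ⟨K, hK⟩
  have hs' : Summable fun n : ℕ =>
      a n ω * ((((n : ℝ) + 1)⁻¹ * ∑ k ∈ Finset.range (n + 1), ξ k ω) / ((n : ℝ) + 2)) := by
    refine Summable.of_norm_bounded (hs.mul_left K) fun n => ?_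
    rw [norm_mul]
    exact mul_le_mul_of_nonneg_right (hK n) (norm_nonneg _)
  refine ⟨_, (hl.sub hs'.hasSum.tendsto_sum_nat).congr fun m => ?_⟩
  rw [← Finset.sum_sub_distrib]
  refine Finset.sum_congr rfl fun n _ => ?_
  rw [mean_increment (fun k => ξ k ω), mul_sub]

/-- The strong law of large numbers. -/
theorem ae_tendsto_mean : ∀ᵐ ω ∂μ, Tendsto
    (fun n : ℕ => ((n : ℝ) + 1)⁻¹ * ∑ k ∈ Finset.range (n + 1), ξ k ω) atTop (𝓝 0) := by
  filter_upwards [hξ.ae_exists_tendsto_increments (a := fun _ _ => 1)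
    (fun n => stronglyMeasurable_const) (Eventually.of_forall fun ω => ⟨1, by simp⟩),
    hξ.ae_summable_mean] with ω ⟨l, hl⟩ hs
  set m : ℕ → ℝ := fun n => ((n : ℝ) + 1)⁻¹ * ∑ k ∈ Finset.range (n + 1), ξ k ω with hm
  have hlim : Tendsto m atTop (𝓝 (l + m 0)) := by
    refine (hl.add_const (m 0)).congr fun n => ?_
    have := Finset.sum_range_sub m n
    simp only [one_mul]
    change ∑ i ∈ Finset.range n, (m (i + 1) - m i) + m 0 = m n
    linarith
  suffices l + m 0 = 0 by rwa [this] at hlim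
  -- The unit-weight sums telescope, so the means converge. A nonzero limit would make the summable
  -- series of `|m n| / (n + 2)` dominate a harmonic series.
  by_contra hne
  have hpos : 0 < |l + m 0| := abs_pos.2 hne
  have hev := (hlim.abs).eventually (lt_mem_nhds (half_lt_self hpos))
  have hsum : Summable fun n : ℕ => 1 / ((n : ℝ) + 2) := by
    refine Summable.of_norm_bounded_eventually_nat (hs.mul_left (2 / |l + m 0|)) ?_
    filter_upwards [hev] with n hn
    rw [abs_div, abs_of_pos (show (0 : ℝ) < (n : ℝ) + 2 by positivity),
      Real.norm_of_nonneg (by positivity), ← mul_div_assoc]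
    gcongr
    rw [div_mul_eq_mul_div, le_div_iff₀ hpos]
    linarith
  have : Summable fun n : ℕ => 1 / (n : ℝ) := by
    rw [← summable_nat_add_iff 2]
    simpa using hsum
  exact Real.not_summable_one_div_natCast this

end IsMartingaleDifference

end OnlineMM

/-! ### Matrices acting on Euclidean vectors -/

namespace OnlineMM

section App

variable {l m n : ℕ}

theorem app_eq (A : Matrix (Fin m) (Fin n) ℝ) (x : Vec n) :
    app A x = WithLp.toLp 2 (A *ᵥ x.ofLp) := rfl

theorem app_mul (A : Matrix (Fin l) (Fin m) ℝ) (B : Matrix (Fin m) (Fin n) ℝ) (x : Vec n) :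
    app (A * B) x = app A (app B x) := by
  simp [app_eq, Matrix.mulVec_mulVec]

theorem app_one (x : Vec n) : app (1 : Matrix (Fin n) (Fin n) ℝ) x = x := by
  simp [app_eq]

theorem app_add (A B : Matrix (Fin m) (Fin n) ℝ) (x : Vec n) :
    app (A + B) x = app A x + app B x := by
  simp [app]

theorem app_smul (a : ℝ) (A : Matrix (Fin m) (Fin n) ℝ) (x : Vec n) :
    app (a • A) x = a • app A x := by
  simp [app]

theorem app_vec_smul (a : ℝ) (A : Matrix (Fin m) (Fin n) ℝ) (x : Vec n) :
    app A (a • x) = a • app A x :=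
  map_smul _ _ _

theorem app_vec_sub (A : Matrix (Fin m) (Fin n) ℝ) (x z : Vec n) :
    app A (x - z) = app A x - app A z :=
  map_sub _ _ _

theorem app_vec_add (A : Matrix (Fin m) (Fin n) ℝ) (x z : Vec n) :
    app A (x + z) = app A x + app A z :=
  map_add _ _ _

theorem app_sum {ι : Type*} (s : Finset ι) (A : ι → Matrix (Fin m) (Fin n) ℝ) (x : Vec n) :
    app (∑ i ∈ s, A i) x = ∑ i ∈ s, app (A i) x := by
  simp [app, LinearMap.sum_apply]

theorem inner_app_eq_sum (A : Matrix (Fin m) (Fin n) ℝ) (x : Vec m) (z : Vec n) :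
    inner ℝ x (app A z) = ∑ i, ∑ j, x i * z j * A i j := by
  simp only [app_eq, PiLp.inner_apply, Matrix.mulVec, dotProduct, RCLike.inner_apply, conj_trivial,
    Finset.sum_mul]
  exact Finset.sum_congr rfl fun i _ => Finset.sum_congr rfl fun j _ => by ring

theorem inner_app_transpose (A : Matrix (Fin m) (Fin n) ℝ) (x : Vec m) (z : Vec n) :
    inner ℝ (app Aᵀ x) z = inner ℝ x (app A z) := by
  rw [real_inner_comm, inner_app_eq_sum, inner_app_eq_sum, Finset.sum_comm]
  exact Finset.sum_congr rfl fun i _ => Finset.sum_congr rfl fun j _ => by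
    rw [Matrix.transpose_apply]; ring

theorem inner_app_of_posSemidef {A : Matrix (Fin n) (Fin n) ℝ} (hA : A.PosSemidef) (x z : Vec n) :
    inner ℝ (app A x) z = inner ℝ x (app A z) := by
  have : Aᵀ = A := by simpa using hA.isHermitian.eq
  rw [← inner_app_transpose, this]

theorem inner_app_nonneg {A : Matrix (Fin n) (Fin n) ℝ} (hA : A.PosSemidef) (x : Vec n) :
    0 ≤ inner ℝ x (app A x) := by
  have := hA.dotProduct_mulVec_nonneg x.ofLp
  simpa [app_eq, EuclideanSpace.inner_eq_star_dotProduct, dotProduct_comm] using this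

/-- The constant is the minimum of the form on the unit sphere; an empty sphere means that the space
is trivial. -/
theorem exists_coercive_of_posDef {A : Matrix (Fin n) (Fin n) ℝ} (hA : A.PosDef) :
    ∃ α, 0 < α ∧ ∀ x : Vec n, α * ‖x‖ ^ 2 ≤ inner ℝ x (app A x) := by
  have hcont : Continuous fun x : Vec n => inner ℝ x (app A x) :=
    continuous_id.inner (Matrix.toEuclideanLin A).continuous_of_finiteDimensional
  have hpos : ∀ x : Vec n, x ≠ 0 → 0 < inner ℝ x (app A x) := by
    intro x hx
    have := hA.dotProduct_mulVec_pos (x := x.ofLp) (by simpa using hx)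
    simpa [app_eq, EuclideanSpace.inner_eq_star_dotProduct, dotProduct_comm] using this
  rcases (Metric.sphere (0 : Vec n) 1).eq_empty_or_nonempty with he | hne
  · refine ⟨1, one_pos, fun x => ?_⟩
    have hx : x = 0 := by
      by_contra hx
      have : ‖x‖⁻¹ • x ∈ Metric.sphere (0 : Vec n) 1 := by
        simp [norm_smul, inv_mul_cancel₀ (norm_ne_zero_iff.2 hx)]
      simp [he] at this
    simp [hx]
  · obtain ⟨x₀, hx₀, hmin⟩ := (isCompact_sphere (0 : Vec n) 1).exists_isMinOn hne
      hcont.continuousOn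
    have hx₀' : x₀ ≠ 0 := by
      rintro rfl
      simp at hx₀
    refine ⟨_, hpos x₀ hx₀', fun x => ?_⟩
    by_cases hx : x = 0
    · simp [hx]
    have hn : ‖x‖ ≠ 0 := norm_ne_zero_iff.2 hx
    have hm : ‖x‖⁻¹ • x ∈ Metric.sphere (0 : Vec n) 1 := by
      simp [norm_smul, inv_mul_cancel₀ hn]
    have := hmin hm
    simp only [mem_ofPred_eq, map_smul, inner_smul_left, inner_smul_right, conj_trivial] at this
    rw [← le_div_iff₀ (by positivity)]
    refine this.trans_eq ?_
    field_simp

theorem continuous_app {α : Type*} [TopologicalSpace α] {A : α → Matrix (Fin m) (Fin n) ℝ}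
    {x : α → Vec n} (hA : Continuous A) (hx : Continuous x) :
    Continuous fun a => app (A a) (x a) := by
  simp only [app_eq]
  have h2 : Continuous fun a => (x a).ofLp := by fun_prop
  exact (PiLp.continuous_toLp 2 _).comp (hA.matrix_mulVec h2)

end App

/-! ### Minimization of a quadratic form over a subspace -/

section Quadratic

theorem eq_zero_of_forall_linear_add_sq_nonneg {a b : ℝ} (h : ∀ t : ℝ, 0 ≤ t * a + t ^ 2 * b) :
    a = 0 := by
  by_contra ha
  have hb : 0 < |b| + 1 := by positivity
  have h1 := h (-(a / (|b| + 1)))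
  have h2 : (-(a / (|b| + 1))) * a + (-(a / (|b| + 1))) ^ 2 * b
      = a ^ 2 / (|b| + 1) ^ 2 * (b - |b| - 1) := by
    field_simp
    ring
  rw [h2] at h1
  have h3 : 0 < a ^ 2 / (|b| + 1) ^ 2 := by positivity
  nlinarith [le_abs_self b]

variable {E : Type*} [NormedAddCommGroup E] [InnerProductSpace ℝ E]

/-- The minimizers of a positive semi-definite quadratic function over a subspace are
characterized by the normal equations. -/
theorem isMin_quadratic_iff {A : E →ₗ[ℝ] E} (hs : ∀ x z, inner ℝ (A x) z = inner ℝ x (A z))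
    (hn : ∀ x, 0 ≤ inner ℝ x (A x)) (c h : E) (W : Submodule ℝ E) {z : E} (hz : z ∈ W) (K : ℝ) :
    (∀ z' ∈ W, K + inner ℝ (A h - c) (z - h) + 1 / 2 * inner ℝ (z - h) (A (z - h))
      ≤ K + inner ℝ (A h - c) (z' - h) + 1 / 2 * inner ℝ (z' - h) (A (z' - h)))
      ↔ ∀ w ∈ W, inner ℝ (A z - c) w = 0 := by
  -- Re-expanding about `z` removes the base point `h` from the first-order term, which becomes `⟨A
  -- z - c, w⟩`.
  have key : ∀ w, K + inner ℝ (A h - c) (z + w - h) + 1 / 2 * inner ℝ (z + w - h) (A (z + w - h))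
      = K + inner ℝ (A h - c) (z - h) + 1 / 2 * inner ℝ (z - h) (A (z - h))
        + inner ℝ (A z - c) w + 1 / 2 * inner ℝ w (A w) := by
    intro w
    have h1 : inner ℝ z (A w) = inner ℝ w (A z) := by rw [← hs, real_inner_comm]
    have h2 : inner ℝ h (A w) = inner ℝ w (A h) := by rw [← hs, real_inner_comm]
    simp only [map_add, map_sub, inner_add_left, inner_add_right, inner_sub_left,
      inner_sub_right, hs]
    linarith
  constructor
  · intro hmin w hw
    refine eq_zero_of_forall_linear_add_sq_nonneg (b := 1 / 2 * inner ℝ w (A w)) fun t => ?_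
    have := hmin (z + t • w) (W.add_mem hz (W.smul_mem t hw))
    rw [key] at this
    simp only [map_smul, inner_smul_left, inner_smul_right, conj_trivial] at this
    nlinarith
  · intro horth z' hz'
    have := key (z' - z)
    rw [add_sub_cancel] at this
    rw [this, horth _ (W.sub_mem hz' hz)]
    linarith [hn (z' - z)]

/-- Nonnegativity of the form at `x - t • A x` with `t = (‖A‖ + 1)⁻¹`. It controls `A x` by the form
even if `A` is degenerate; the `+ 1` covers `A = 0`. -/
theorem norm_sq_le_of_nonneg {A : E →L[ℝ] E} (hs : ∀ x z, inner ℝ (A x) z = inner ℝ x (A z))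
    (hn : ∀ x, 0 ≤ inner ℝ x (A x)) (x : E) : ‖A x‖ ^ 2 ≤ (‖A‖ + 1) * inner ℝ x (A x) := by
  have hK : 0 < ‖A‖ + 1 := by positivity
  set t := (‖A‖ + 1)⁻¹ with ht
  have h1 := hn (x - t • A x)
  have h2 : inner ℝ (x - t • A x) (A (x - t • A x))
      = inner ℝ x (A x) - 2 * t * ‖A x‖ ^ 2 + t ^ 2 * inner ℝ (A x) (A (A x)) := by
    simp only [map_sub, map_smul, inner_sub_left, inner_sub_right, inner_smul_left,
      inner_smul_right, conj_trivial, ← hs x, real_inner_self_eq_norm_sq]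
    ring
  have h3 : inner ℝ (A x) (A (A x)) ≤ (‖A‖ + 1) * ‖A x‖ ^ 2 := by
    refine (real_inner_le_norm _ _).trans ?_
    have := A.le_opNorm (A x)
    nlinarith [norm_nonneg (A x)]
  have h4 : t * (‖A‖ + 1) = 1 := inv_mul_cancel₀ hK.ne'
  have h5 : t ^ 2 * inner ℝ (A x) (A (A x)) ≤ t * ‖A x‖ ^ 2 := by
    calc _ ≤ t ^ 2 * ((‖A‖ + 1) * ‖A x‖ ^ 2) := by gcongr
      _ = (t * (‖A‖ + 1)) * (t * ‖A x‖ ^ 2) := by ring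
      _ = _ := by rw [h4, one_mul]
  have h6 : t * ‖A x‖ ^ 2 ≤ inner ℝ x (A x) := by linarith
  calc ‖A x‖ ^ 2 = (‖A‖ + 1) * (t * ‖A x‖ ^ 2) := by
        rw [← mul_assoc, mul_comm _ t, h4, one_mul]
    _ ≤ _ := by gcongr

end Quadratic

/-! ### Measurability of the minimizers -/

section Measurability

variable {m n : ℕ}

instance instBorelSpaceMatrix : BorelSpace (Matrix (Fin m) (Fin n) ℝ) :=
  inferInstanceAs (BorelSpace (Fin m → Fin n → ℝ))

instance instSecondCountableMatrix : SecondCountableTopology (Matrix (Fin m) (Fin n) ℝ) :=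
  inferInstanceAs (SecondCountableTopology (Fin m → Fin n → ℝ))

/-- The data `(A, D, c)` of the minimization of `½⟨z, A z⟩ - ⟨c, z⟩` over `ran D`. -/
abbrev QuadraticData (n m : ℕ) :=
  Matrix (Fin n) (Fin n) ℝ × Matrix (Fin n) (Fin m) ℝ × Vec n

/-- The matrix `Dᵀ A D + ε I`. -/
def regularizedMatrix (ε : ℝ) (q : QuadraticData n m) : Matrix (Fin m) (Fin m) ℝ :=
  (q.2.1)ᵀ * q.1 * q.2.1 + ε • 1

/-- The minimizer over `ran D` regularized by `ε`. -/
noncomputable def regularizedSolution (ε : ℝ) (q : QuadraticData n m) : Vec n :=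
  app q.2.1 (app (regularizedMatrix ε q)⁻¹ (app (q.2.1)ᵀ q.2.2))

/-- The limit of the regularized minimizers. -/
noncomputable def limitSolution (q : QuadraticData n m) : Vec n :=
  limUnder atTop fun k : ℕ => regularizedSolution (1 / ((k : ℝ) + 1)) q

/-- Writing the inverse as adjugate over determinant leaves continuous maps and one scalar
inversion, measurable even where the determinant vanishes. -/
theorem measurable_regularizedSolution (ε : ℝ) :
    Measurable (regularizedSolution ε : QuadraticData n m → Vec n) := by
  have hM : Continuous (regularizedMatrix ε : QuadraticData n m → _) := by
    unfold regularizedMatrix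
    fun_prop
  have hD : Continuous fun q : QuadraticData n m => q.2.1 := by fun_prop
  have e : (regularizedSolution ε : QuadraticData n m → Vec n) = fun q =>
      (regularizedMatrix ε q).det⁻¹ •
        app q.2.1 (app (regularizedMatrix ε q).adjugate (app (q.2.1)ᵀ q.2.2)) := by
    ext1 q
    rw [regularizedSolution, Matrix.inv_def, Ring.inverse_eq_inv', app_smul, app_vec_smul]
  rw [e]
  refine Measurable.smul hM.matrix_det.measurable.inv ?_
  exact (continuous_app hD (continuous_app hM.matrix_adjugate
    (continuous_app hD.matrix_transpose (by fun_prop)))).measurable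

theorem measurable_limitSolution : Measurable (limitSolution : QuadraticData n m → Vec n) :=
  (StronglyMeasurable.limUnder fun k : ℕ =>
    (measurable_regularizedSolution (1 / ((k : ℝ) + 1))).stronglyMeasurable).measurable

/-- The data for which `A` is injective on `ran D`. -/
def injectiveData (n m : ℕ) : Set (QuadraticData n m) :=
  {q | ∀ w ∈ ran q.2.1, app q.1 w = 0 → w = 0}

theorem exists_bound_of_mem_injectiveData {q : QuadraticData n m} (hq : q ∈ injectiveData n m) :
    ∃ κ : ℝ, 0 ≤ κ ∧ ∀ w ∈ ran q.2.1, ‖w‖ ≤ κ * ‖app q.1 w‖ := by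
  have hker : ((Matrix.toEuclideanLin q.1).domRestrict (ran q.2.1)).ker = ⊥ := by
    rw [LinearMap.ker_eq_bot']
    intro w hw
    exact Subtype.ext (hq w.1 w.2 hw)
  obtain ⟨κ, -, hκ⟩ := LinearMap.exists_antilipschitzWith _ hker
  refine ⟨κ, κ.2, fun w hw => ?_⟩
  simpa using hκ.le_mul_dist ⟨w, hw⟩ 0

/-- In finite dimension injectivity is a quantitative lower bound, which can be tested with integer
constants on a dense sequence of coefficients. -/
theorem measurableSet_injectiveData : MeasurableSet (injectiveData n m) := by
  have e : injectiveData n m = ⋃ k : ℕ, ⋂ j : ℕ, {q |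
      ‖app q.2.1 (TopologicalSpace.denseSeq (Vec m) j)‖
        ≤ k * ‖app q.1 (app q.2.1 (TopologicalSpace.denseSeq (Vec m) j))‖} := by
    ext q
    simp only [mem_iUnion, mem_iInter, mem_ofPred_eq]
    constructor
    · intro hq
      obtain ⟨κ, -, hκ⟩ := exists_bound_of_mem_injectiveData hq
      obtain ⟨k, hk⟩ := exists_nat_ge κ
      refine ⟨k, fun j => (hκ _ ⟨_, rfl⟩).trans ?_⟩
      gcongr
    · rintro ⟨k, hk⟩ w ⟨u, rfl⟩ hw
      have hcl : IsClosed {u : Vec m | ‖app q.2.1 u‖ ≤ k * ‖app q.1 (app q.2.1 u)‖} := by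
        have h1 : Continuous fun u : Vec m => app q.2.1 u :=
          continuous_app continuous_const continuous_id
        exact isClosed_le h1.norm ((continuous_app continuous_const h1).norm.const_mul _)
      have hu : u ∈ {u : Vec m | ‖app q.2.1 u‖ ≤ k * ‖app q.1 (app q.2.1 u)‖} := by
        refine closure_minimal ?_ hcl ((TopologicalSpace.denseRange_denseSeq (Vec m)) u)
        rintro _ ⟨j, rfl⟩
        exact hk j
      have hu' : ‖app q.2.1 u‖ ≤ k * ‖app q.1 (app q.2.1 u)‖ := hu
      rw [show app q.1 (app q.2.1 u) = 0 from hw, norm_zero, mul_zero] at hu'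
      exact norm_le_zero_iff.1 hu'
  rw [e]
  refine MeasurableSet.iUnion fun k => MeasurableSet.iInter fun j => ?_
  have h1 : Continuous fun q : QuadraticData n m =>
      app q.2.1 (TopologicalSpace.denseSeq (Vec m) j) :=
    continuous_app (by fun_prop) continuous_const
  exact measurableSet_le h1.norm.measurable
    ((continuous_app continuous_fst h1).norm.const_mul _).measurable

/-- When the minimizer is unique, the regularized minimizers converge to it. -/
theorem limitSolution_eq {q : QuadraticData n m} (hA : q.1.PosSemidef)
    (hq : q ∈ injectiveData n m) {z : Vec n} (hz : z ∈ ran q.2.1)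
    (horth : ∀ w ∈ ran q.2.1, inner ℝ (app q.1 z - q.2.2) w = 0) : limitSolution q = z := by
  obtain ⟨A, D, c⟩ := q
  obtain ⟨u, rfl⟩ := hz
  simp only at hA horth
  obtain ⟨κ, hκ0, hκ⟩ := exists_bound_of_mem_injectiveData hq
  simp only at hκ
  refine Tendsto.limUnder_eq ?_
  set T : Vec n →L[ℝ] Vec n := (Matrix.toEuclideanLin A).toContinuousLinearMap with hT
  have hTA : ∀ x, T x = app A x := fun x => rfl
  have bound : ∀ ε : ℝ, 0 < ε → ‖regularizedSolution ε (A, D, c) - app D u‖ ^ 2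
      ≤ (κ ^ 2 * ((‖T‖ + 1) * ‖u‖ ^ 2)) * ε := by
    intro ε hε
    set G := regularizedMatrix ε (A, D, c) with hG
    have hGdef : G = Dᵀ * A * D + ε • 1 := rfl
    have hGpos : G.PosDef := by
      have h1 : (Dᵀ * A * D).PosSemidef := by
        simpa using hA.conjTranspose_mul_mul_same D
      exact Matrix.PosDef.posSemidef_add h1 (Matrix.PosDef.one.smul hε)
    set u' := app G⁻¹ (app Dᵀ c) with hu'
    have hsol : app G u' = app Dᵀ c := by
      rw [hu', ← app_mul, Matrix.mul_nonsing_inv _ ((Matrix.isUnit_iff_isUnit_det _).1 hGpos.isUnit),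
        app_one]
    have hc : app Dᵀ c = app Dᵀ (app A (app D u)) := by
      refine ext_inner_right ℝ fun w => ?_
      rw [inner_app_transpose, inner_app_transpose]
      have := horth (app D w) ⟨w, rfl⟩
      rw [inner_sub_left] at this
      linarith
    set w := u' - u with hw
    have hDw : app D w = regularizedSolution ε (A, D, c) - app D u := by
      rw [hw, app_vec_sub]; rfl
    -- The exact coefficients `u` satisfy the unregularized equation and `u'` the regularized one,
    -- so their difference `w` solves a system with right-hand side of order `ε`.
    have h1 : app G w = -(ε • u) := by
      rw [hw, app_vec_sub, hsol, hc, hGdef, app_add, app_smul, app_one, app_mul, app_mul]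
      abel
    have h2 : inner ℝ w (app G w) = inner ℝ (app D w) (app A (app D w)) + ε * ‖w‖ ^ 2 := by
      rw [hGdef, app_add, app_smul, app_one, app_mul, app_mul, inner_add_right, inner_smul_right,
        real_inner_self_eq_norm_sq, real_inner_comm, inner_app_transpose, real_inner_comm]
    have h3 : inner ℝ w (app G w) ≤ ε * (‖w‖ ^ 2 + ‖u‖ ^ 2) := by
      rw [h1, inner_neg_right, inner_smul_right, ← mul_neg]
      gcongr
      refine (neg_le_abs _).trans ((abs_real_inner_le_norm _ _).trans ?_)
      nlinarith [sq_nonneg (‖w‖ - ‖u‖), norm_nonneg w, norm_nonneg u]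
    -- The terms `ε * ‖w‖ ^ 2` cancel, so no bound on `w` is needed although `D` may have a kernel.
    have h4 : inner ℝ (app D w) (app A (app D w)) ≤ ε * ‖u‖ ^ 2 := by linarith
    have h5 := norm_sq_le_of_nonneg (A := T) (inner_app_of_posSemidef hA) (inner_app_nonneg hA)
      (app D w)
    rw [hTA] at h5
    rw [← hDw]
    calc ‖app D w‖ ^ 2 ≤ (κ * ‖app A (app D w)‖) ^ 2 := by
          gcongr
          exact hκ _ ⟨w, rfl⟩
      _ = κ ^ 2 * ‖app A (app D w)‖ ^ 2 := by ring
      _ ≤ κ ^ 2 * ((‖T‖ + 1) * (ε * ‖u‖ ^ 2)) := by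
          gcongr
          exact h5.trans (by gcongr)
      _ = _ := by ring
  rw [tendsto_iff_norm_sub_tendsto_zero]
  have h0 : Tendsto (fun k : ℕ => (κ ^ 2 * ((‖T‖ + 1) * ‖u‖ ^ 2)) * (1 / ((k : ℝ) + 1))) atTop
      (𝓝 0) := by
    have := (tendsto_one_div_add_atTop_nhds_zero_nat (𝕜 := ℝ)).const_mul
      (κ ^ 2 * ((‖T‖ + 1) * ‖u‖ ^ 2))
    rwa [mul_zero] at this
  have h1 := (squeeze_zero (fun k => sq_nonneg _)
    (fun k : ℕ => bound (1 / ((k : ℝ) + 1)) (by positivity)) h0).sqrt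
  simpa using h1

end Measurability

end OnlineMM

/-! ### The sample costs -/

namespace OnlineMM

/-- The continuous linear map `x ↦ A x`. -/
noncomputable def toCLM {m n : ℕ} (A : Matrix (Fin m) (Fin n) ℝ) : Vec n →L[ℝ] Vec m :=
  (Matrix.toEuclideanLin A).toContinuousLinearMap

theorem toCLM_apply {m n : ℕ} (A : Matrix (Fin m) (Fin n) ℝ) (x : Vec n) :
    toCLM A x = app A x := rfl

theorem toCLM_sub {m n : ℕ} (A B : Matrix (Fin m) (Fin n) ℝ) :
    toCLM (A - B) = toCLM A - toCLM B := by
  simp [toCLM]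

theorem continuous_toCLM {m n : ℕ} :
    Continuous (toCLM : Matrix (Fin m) (Fin n) ℝ → Vec n →L[ℝ] Vec m) :=
  (LinearMap.toContinuousLinearMap.toLinearMap ∘ₗ
    (Matrix.toEuclideanLin (𝕜 := ℝ) (m := Fin m) (n := Fin n)).toLinearMap
    ).continuous_of_finiteDimensional

theorem toCLM_adjoint {m n : ℕ} (A : Matrix (Fin m) (Fin n) ℝ) (x : Vec m) :
    (toCLM A).adjoint x = app Aᵀ x := by
  refine ext_inner_right ℝ fun z => ?_
  rw [ContinuousLinearMap.adjoint_inner_left, inner_app_transpose, toCLM_apply]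

theorem hasGradientAt_quadratic {E : Type*} [NormedAddCommGroup E] [InnerProductSpace ℝ E]
    [CompleteSpace E] {B : E →L[ℝ] E} (hB : ∀ x z, inner ℝ (B x) z = inner ℝ x (B z)) (c x : E) :
    HasGradientAt (fun z => 1 / 2 * inner ℝ z (B z) - inner ℝ c z) (B x - c) x := by
  rw [hasGradientAt_iff_hasFDerivAt]
  have h1 := (((hasFDerivAt_id x).inner ℝ B.hasFDerivAt).const_mul (1 / 2)).sub
    ((innerSL ℝ c).hasFDerivAt (x := x))
  refine h1.congr_fderiv ?_
  ext z
  rw [InnerProductSpace.toDual_apply_apply]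
  simp [inner_sub_left, hB x z, ← hB z x, real_inner_comm]
  ring

namespace Regularizer

variable {N : ℕ} (reg : Regularizer N)

/-- The operators of the regularizer. -/
noncomputable abbrev L (s : Fin reg.S) : Vec N →L[ℝ] Vec (reg.P s) := toCLM (reg.V s)

variable {reg}

theorem Assumption1.isPotential (h₁ : reg.Assumption1) (s : Fin reg.S) : IsPotential (reg.ψ s) where
  even := h₁.even s
  contDiff := h₁.contDiff s
  limit_zero := h₁.limit_zero s
  concave_sqrt := h₁.concave_sqrt s
  weight_nonneg t ht := by
    obtain ⟨_, -, h⟩ := h₁.weight_bounded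
    exact (h s t ht).1

theorem Assumption1.isQuadraticallyMajorized (h₁ : reg.Assumption1) :
    IsQuadraticallyMajorized (penalty reg.ψ reg.L reg.v) (penaltyOp reg.ψ reg.L reg.v)
      (penaltyVec reg.ψ reg.L reg.v) := by
  obtain ⟨C, -, hC⟩ := h₁.weight_bounded
  exact
    { nonneg := inner_penaltyOp_nonneg h₁.isPotential
      le := penalty_le h₁.isPotential
      continuous := continuous_penalty h₁.isPotential
      continuous_op := continuous_penaltyOp h₁.isPotential
      continuous_vec := continuous_penaltyVec h₁.isPotential
      bounded_op := ⟨_, norm_penaltyOp_le h₁.isPotential fun s t ht => (hC s t ht).2⟩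
      bounded_vec := ⟨_, norm_penaltyVec_le h₁.isPotential fun s t ht => (hC s t ht).2⟩ }

variable (reg)

theorem stack_eq_sum (h : Vec N) : reg.stackᵀ * Matrix.diagonal (reg.b h) * reg.stack
    = ∑ s, weight (reg.ψ s) ‖app (reg.V s) h - reg.v s‖ • ((reg.V s)ᵀ * reg.V s) := by
  ext i j
  rw [Matrix.mul_apply, Fintype.sum_sigma, Matrix.sum_apply]
  refine Finset.sum_congr rfl fun s _ => ?_
  rw [Matrix.smul_apply, Matrix.mul_apply, Finset.smul_sum]
  refine Finset.sum_congr rfl fun k _ => ?_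
  simp [Matrix.mul_diagonal, stack, b]
  ring

theorem app_stack (h x : Vec N) :
    app (reg.stackᵀ * Matrix.diagonal (reg.b h) * reg.stack) x
      = penaltyOp reg.ψ reg.L reg.v h x := by
  rw [stack_eq_sum, app_sum, penaltyOp, sum_apply]
  refine Finset.sum_congr rfl fun s _ => ?_
  rw [app_smul, app_mul, smul_apply, ContinuousLinearMap.comp_apply, toCLM_adjoint]
  rfl

theorem posSemidef_stack (h₁ : reg.Assumption1) (h : Vec N) :
    (reg.stackᵀ * Matrix.diagonal (reg.b h) * reg.stack).PosSemidef := by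
  have hd : (Matrix.diagonal (reg.b h)).PosSemidef :=
    Matrix.PosSemidef.diagonal fun i => (h₁.isPotential i.1).weight_nonneg _ (norm_nonneg _)
  simpa using hd.conjTranspose_mul_mul_same reg.stack

theorem Ψ_eq (h : Vec N) : reg.Ψ h
    = 1 / 2 * inner ℝ h (app reg.V₀ h) - inner ℝ reg.v₀ h + penalty reg.ψ reg.L reg.v h := rfl

end Regularizer

section Sample

variable {N Q : ℕ} (reg : Regularizer N) (x : ℕ → Matrix (Fin N) (Fin Q) ℝ) (y : ℕ → Vec Q)

/-- The sample vector `(1/n) ∑_{k ≤ n} X_k y_k + v₀` (indices shifted). -/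
noncomputable def sampleVec (n : ℕ) : Vec N :=
  ((n : ℝ) + 1)⁻¹ • ∑ k ∈ Finset.range (n + 1), app (x k) (y k) + reg.v₀

theorem norm_residual_sq (A : Matrix (Fin N) (Fin Q) ℝ) (w : Vec Q) (h : Vec N) :
    ‖w - app Aᵀ h‖ ^ 2 = ‖w‖ ^ 2 - 2 * inner ℝ (app A w) h + inner ℝ h (app (A * Aᵀ) h) := by
  rw [norm_sub_sq_real, ← real_inner_self_eq_norm_sq (app Aᵀ h), inner_app_transpose, app_mul,
    real_inner_comm, inner_app_transpose, real_inner_comm]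

theorem posSemidef_sampleR (n : ℕ) : (sampleR x n).PosSemidef := by
  refine Matrix.PosSemidef.smul (Matrix.posSemidef_sum _ fun k _ => ?_) (by positivity)
  simpa using Matrix.posSemidef_self_mul_conjTranspose (x k)

/-- The observations act on the minimization only through two empirical means; the last term is
independent of `h`. -/
theorem sampleCost_eq (n : ℕ) (h : Vec N) : sampleCost reg x y n h
    = 1 / 2 * inner ℝ h (toCLM (sampleR x n + reg.V₀) h) - inner ℝ (sampleVec reg x y n) h
      + penalty reg.ψ reg.L reg.v h
      + (2 * ((n : ℝ) + 1))⁻¹ * ∑ k ∈ Finset.range (n + 1), ‖y k‖ ^ 2 := by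
  have hn : (n : ℝ) + 1 ≠ 0 := by positivity
  simp only [sampleCost, Regularizer.Ψ_eq, norm_residual_sq, Finset.sum_add_distrib,
    Finset.sum_sub_distrib, toCLM_apply, app_add, inner_add_right, inner_add_left, sampleVec,
    sampleR, app_smul, app_sum, inner_smul_right, inner_smul_left, inner_sum, sum_inner,
    conj_trivial, ← Finset.mul_sum]
  field_simp
  ring

variable {reg}

theorem symm_toCLM {A : Matrix (Fin N) (Fin N) ℝ} (hA : A.PosSemidef) (z w : Vec N) :
    inner ℝ (toCLM A z) w = inner ℝ z (toCLM A w) :=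
  inner_app_of_posSemidef hA z w

theorem hasGradientAt_quadratic_add_penalty (h₁ : reg.Assumption1) {A : Matrix (Fin N) (Fin N) ℝ}
    (hA : A.PosSemidef) (c : Vec N) (K : ℝ) (h : Vec N) :
    HasGradientAt (fun z => 1 / 2 * inner ℝ z (toCLM A z) - inner ℝ c z
        + penalty reg.ψ reg.L reg.v z + K)
      (toCLM A h - c + (penaltyOp reg.ψ reg.L reg.v h h - penaltyVec reg.ψ reg.L reg.v h)) h := by
  have h1 := hasGradientAt_quadratic (symm_toCLM hA) c h
  have h2 := hasGradientAt_penalty (L := reg.L) (v := reg.v) h₁.isPotential h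
  rw [hasGradientAt_iff_hasFDerivAt] at *
  rw [map_add]
  exact (h1.add h2).add_const K

theorem gradient_sampleCost (h₁ : reg.Assumption1) (n : ℕ) (h : Vec N) :
    ∇ (sampleCost reg x y n) h = toCLM (sampleR x n + reg.V₀) h - sampleVec reg x y n
      + (penaltyOp reg.ψ reg.L reg.v h h - penaltyVec reg.ψ reg.L reg.v h) := by
  have := hasGradientAt_quadratic_add_penalty h₁ ((posSemidef_sampleR x n).add reg.posSemidef_V₀)
    (sampleVec reg x y n) ((2 * ((n : ℝ) + 1))⁻¹ * ∑ k ∈ Finset.range (n + 1), ‖y k‖ ^ 2) h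
  rw [← funext (sampleCost_eq reg x y n)] at this
  exact this.gradient

theorem app_curvature (n : ℕ) (h z : Vec N) : app (curvature reg x n h) z
    = toCLM (sampleR x n + reg.V₀) z + penaltyOp reg.ψ reg.L reg.v h z := by
  rw [curvature, app_add, reg.app_stack, toCLM_apply]

theorem posSemidef_curvature (h₁ : reg.Assumption1) (n : ℕ) (h : Vec N) :
    (curvature reg x n h).PosSemidef :=
  ((posSemidef_sampleR x n).add reg.posSemidef_V₀).add (reg.posSemidef_stack h₁ h)

/-- The gradient at `h` is the curvature matrix applied to `h` minus a vector, so the normal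
equations take the form of a linear system in `z`. -/
theorem mem_argminSurrogate_iff (h₁ : reg.Assumption1) (n : ℕ) (h : Vec N) {M : ℕ}
    (D : Matrix (Fin N) (Fin M) ℝ) (z : Vec N) :
    z ∈ argminSurrogate reg x y n h D ↔ z ∈ ran D ∧ ∀ w ∈ ran D,
      inner ℝ (app (curvature reg x n h) z
        - (sampleVec reg x y n + penaltyVec reg.ψ reg.L reg.v h)) w = 0 := by
  refine and_congr_right fun hz => ?_
  have hA := posSemidef_curvature x h₁ n h
  rw [← isMin_quadratic_iff (A := Matrix.toEuclideanLin (curvature reg x n h))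
    (inner_app_of_posSemidef hA) (inner_app_nonneg hA) _ h (ran D) hz (sampleCost reg x y n h)]
  have e : ∇ (sampleCost reg x y n) h = app (curvature reg x n h) h
      - (sampleVec reg x y n + penaltyVec reg.ψ reg.L reg.v h) := by
    rw [gradient_sampleCost x y h₁, app_curvature]
    abel
  simp only [surrogate, e]

/-- If the curvature is degenerate on the subspace, the minimizer is not unique. -/
theorem not_subsingleton_argminSurrogate (h₁ : reg.Assumption1) {n : ℕ} {h : Vec N} {M : ℕ}
    {D : Matrix (Fin N) (Fin M) ℝ} {z w : Vec N} (hz : z ∈ argminSurrogate reg x y n h D)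
    (hw : w ∈ ran D) (hAw : app (curvature reg x n h) w = 0) (hw0 : w ≠ 0) :
    ¬ (argminSurrogate reg x y n h D).Subsingleton := by
  intro hs
  have hzw : z + w ∈ argminSurrogate reg x y n h D := by
    rw [mem_argminSurrogate_iff x y h₁] at hz ⊢
    refine ⟨(ran D).add_mem hz.1 hw, ?_⟩
    rw [app_vec_add, hAw, add_zero]
    exact hz.2
  exact hw0 (by simpa using hs hzw hz)

theorem isSubspaceDescent (h₁ : reg.Assumption1) {M : ℕ → ℕ}
    {D : (n : ℕ) → Matrix (Fin N) (Fin (M n)) ℝ} {h : ℕ → Vec N}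
    (hmin : ∀ n, h (n + 1) ∈ argminSurrogate reg x y n (h n) (D n))
    (hmem : ∀ n, ∇ (sampleCost reg x y n) (h n) ∈ ran (D n) ∧ h n ∈ ran (D n)) :
    IsSubspaceDescent (penaltyOp reg.ψ reg.L reg.v) (penaltyVec reg.ψ reg.L reg.v)
      (fun n => toCLM (sampleR x n + reg.V₀)) (sampleVec reg x y) (fun n => ran (D n)) h where
  symm n := symm_toCLM ((posSemidef_sampleR x n).add reg.posSemidef_V₀)
  mem n := (hmem n).2
  mem_succ n := (hmin n).1
  gradient_mem n := by
    rw [← gradient_sampleCost x y h₁]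
    exact (hmem n).1
  orthogonal n w hw := by
    have := ((mem_argminSurrogate_iff x y h₁ n (h n) (D n) _).1 (hmin n)).2 w hw
    rw [app_curvature] at this
    rw [← this]
    congr 1
    abel

end Sample

/-! ### Measurability of the data -/

section DataMeasurability

variable {α : Type*} [MeasurableSpace α] {N Q : ℕ} {reg : Regularizer N}
  {x : ℕ → α → Matrix (Fin N) (Fin Q) ℝ} {y : ℕ → α → Vec Q} {g : α → Vec N} {n : ℕ}

theorem measurable_matrix_of_entries {m n : ℕ} {A : α → Matrix (Fin m) (Fin n) ℝ}
    (hA : ∀ i j, Measurable fun a => A a i j) : Measurable A :=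
  measurable_pi_lambda _ fun i => measurable_pi_lambda _ fun j => hA i j

theorem measurable_app_prod {m n : ℕ} :
    Measurable fun q : Matrix (Fin m) (Fin n) ℝ × Vec n => app q.1 q.2 := by
  have hc : Continuous fun q : Matrix (Fin m) (Fin n) ℝ × Vec n => app q.1 q.2 :=
    continuous_app continuous_fst continuous_snd
  exact hc.measurable

theorem measurable_app {m n : ℕ} {A : α → Matrix (Fin m) (Fin n) ℝ} {z : α → Vec n}
    (hA : Measurable A) (hz : Measurable z) : Measurable fun a => app (A a) (z a) := by
  have h2 : Measurable fun a => (A a, z a) := hA.prodMk hz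
  have h3 := Measurable.comp measurable_app_prod h2
  exact h3

theorem measurable_sampleVec (hx : ∀ k ≤ n, Measurable (x k)) (hy : ∀ k ≤ n, Measurable (y k)) :
    Measurable fun a => sampleVec reg (x · a) (y · a) n := by
  have h2 : Measurable fun a => ∑ k ∈ Finset.range (n + 1), app (x k a) (y k a) := by
    refine Finset.measurable_fun_sum _ fun k hk => ?_
    have hk' : k ≤ n := by simpa [Nat.lt_succ_iff] using hk
    exact measurable_app (hx k hk') (hy k hk')
  exact (h2.const_smul ((n : ℝ) + 1)⁻¹).add_const _

theorem measurable_curvature (h₁ : reg.Assumption1) (hx : ∀ k ≤ n, Measurable (x k))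
    (hg : Measurable g) : Measurable fun a => curvature reg (x · a) n (g a) := by
  have hc : Continuous fun z : Vec N => reg.stackᵀ * Matrix.diagonal (reg.b z) * reg.stack := by
    simp only [Regularizer.stack_eq_sum]
    refine continuous_finsetSum _ fun s _ => Continuous.fun_smul ?_ continuous_const
    exact (h₁.isPotential s).continuous_weight.comp
      ((continuous_app continuous_const continuous_id).sub continuous_const).norm
  refine measurable_matrix_of_entries fun i j => ?_
  have h2 : Measurable fun a => sampleR (x · a) n i j := by
    simp only [sampleR, Matrix.smul_apply, Matrix.sum_apply, smul_eq_mul]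
    refine Measurable.const_mul (Finset.measurable_fun_sum _ fun k hk => ?_) _
    have hk' : k ≤ n := by simpa [Nat.lt_succ_iff] using hk
    have : Continuous fun A : Matrix (Fin N) (Fin Q) ℝ => (A * Aᵀ) i j :=
      (continuous_id.matrix_mul continuous_id.matrix_transpose).matrix_elem i j
    exact this.measurable.comp (hx k hk')
  exact (h2.add_const _).add ((hc.matrix_elem i j).measurable.comp hg)

end DataMeasurability

end OnlineMM

/-! ### The observations -/

namespace OnlineMM

section Observations

variable {Ω : Type*} {N Q : ℕ} {X : ℕ → Ω → Matrix (Fin N) (Fin Q) ℝ} {y : ℕ → Ω → Vec Q}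

theorem measurable_dataSigma {k n : ℕ} (hk : k ≤ n) :
    Measurable[dataSigma X y n] fun ω => (X k ω, y k ω) :=
  (comap_measurable _).mono (le_iSup₂ (f := fun (k : ℕ) (_ : k ≤ n) =>
    MeasurableSpace.comap (fun ω => (X k ω, y k ω)) inferInstance) k hk) le_rfl

theorem dataSigma_mono : Monotone (dataSigma X y) := fun _ _ hmn =>
  iSup₂_le fun k hk => le_iSup₂ (f := fun (k : ℕ) (_ : k ≤ _) =>
    MeasurableSpace.comap (fun ω => (X k ω, y k ω)) inferInstance) k (hk.trans hmn)

variable [m0 : MeasurableSpace Ω] {μ : Measure Ω}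

theorem dataSigma_le (hX : ∀ n, Measurable (X n)) (hy : ∀ n, Measurable (y n)) (n : ℕ) :
    dataSigma X y n ≤ m0 :=
  iSup₂_le fun k _ => ((hX k).prodMk (hy k)).comap_le

/-- The filtration generated by the observations. -/
def dataFiltration (hX : ∀ n, Measurable (X n)) (hy : ∀ n, Measurable (y n)) : Filtration ℕ m0 where
  seq := dataSigma X y
  mono' := dataSigma_mono
  le' := dataSigma_le hX hy

/-- The `n`-th coordinate is the initial one after `n` law-preserving shifts. -/
theorem IsStationaryErgodic.map_eq (hX : ∀ n, Measurable (X n)) (hy : ∀ n, Measurable (y n))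
    (hst : IsStationaryErgodic X y μ) (n : ℕ) :
    μ.map (fun ω => (X n ω, y n ω)) = μ.map (fun ω => (X 0 ω, y 0 ω)) := by
  have hseq : Measurable fun ω n => (X n ω, y n ω) :=
    measurable_pi_lambda _ fun n => (hX n).prodMk (hy n)
  have hmp := (Ergodic.toMeasurePreserving hst).iterate n
  have hit : ∀ (n : ℕ) (z : ℕ → Matrix (Fin N) (Fin Q) ℝ × Vec Q),
      (fun (z : ℕ → Matrix (Fin N) (Fin Q) ℝ × Vec Q) n => z (n + 1))^[n] z 0 = z n := by
    intro n
    induction n with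
    | zero => intro z; rfl
    | succ n ih => intro z; rw [Function.iterate_succ_apply, ih]
  have h0 : μ.map (fun ω => (X 0 ω, y 0 ω))
      = (μ.map fun ω n => (X n ω, y n ω)).map fun z => z 0 :=
    (Measure.map_map (measurable_pi_apply 0) hseq).symm
  have hn : μ.map (fun ω => (X n ω, y n ω))
      = (μ.map fun ω n => (X n ω, y n ω)).map fun z => z n :=
    (Measure.map_map (measurable_pi_apply n) hseq).symm
  rw [h0, hn]
  conv_rhs => rw [← hmp.map_eq, Measure.map_map (measurable_pi_apply 0) hmp.measurable]
  congr 1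
  ext1 z
  exact (hit n z).symm

/-- Stationarity gives all centred terms the same second moment, which serves as the uniform `L²`
bound. -/
theorem isMartingaleDifference_of_condExp [IsProbabilityMeasure μ] (hX : ∀ n, Measurable (X n))
    (hy : ∀ n, Measurable (y n)) (hst : IsStationaryErgodic X y μ)
    {φ : Matrix (Fin N) (Fin Q) ℝ × Vec Q → ℝ} (hφ : Measurable φ) {a : ℝ}
    (hL2 : ∀ n, MemLp (fun ω => φ (X n ω, y n ω)) 2 μ)
    (hcond : ∀ n, μ[fun ω => φ (X (n + 1) ω, y (n + 1) ω) | dataSigma X y n] =ᵐ[μ] fun _ => a) :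
    IsMartingaleDifference (dataFiltration hX hy) μ (fun n ω => φ (X n ω, y n ω) - a)
      (∫ ω, (φ (X 0 ω, y 0 ω) - a) ^ 2 ∂μ) where
  adapted n := by
    have h1 := hφ.comp (measurable_dataSigma (X := X) (y := y) (le_refl n))
    exact (h1.sub_const a).stronglyMeasurable
  memLp n := (hL2 n).sub (memLp_const a)
  sq_le n := by
    have hm : Measurable fun q => (φ q - a) ^ 2 := (hφ.sub_const a).pow_const 2
    have h0 := integral_map ((hX 0).prodMk (hy 0)).aemeasurable
      (hm.aestronglyMeasurable (μ := μ.map fun ω => (X 0 ω, y 0 ω)))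
    have hn := integral_map ((hX n).prodMk (hy n)).aemeasurable
      (hm.aestronglyMeasurable (μ := μ.map fun ω => (X n ω, y n ω)))
    rw [← h0, ← hn, hst.map_eq hX hy n]
  condExp n := by
    have h1 := condExp_sub (m := dataSigma X y n) ((hL2 (n + 1)).integrable (by norm_num))
      (integrable_const (μ := μ) a)
    have h2 := condExp_const (μ := μ) (dataSigma_le hX hy n) a
    change μ[fun ω => φ (X (n + 1) ω, y (n + 1) ω) - a | dataSigma X y n] =ᵐ[μ] 0
    filter_upwards [h1, hcond n] with ω h1 h3
    rw [h2, Pi.sub_apply, h3, sub_self] at h1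
    exact h1

/-- Fourth moments of the entries make the products in `X Xᵀ` and `X y` square-integrable. -/
theorem holderTriple_four : ENNReal.HolderTriple 4 4 2 where
  inv_add_inv_eq_inv := by
    have : (4 : ENNReal)⁻¹ = 2⁻¹ * 2⁻¹ := by
      rw [← ENNReal.mul_inv (by norm_num) (by norm_num)]
      norm_num
    rw [this, ← mul_add, ENNReal.inv_two_add_inv_two, mul_one]

theorem memLp_XX (hXm : ∀ n i j, MemLp (fun ω => X n ω i j) 4 μ) (n : ℕ) (i j : Fin N) :
    MemLp (fun ω => (X n ω * (X n ω)ᵀ) i j) 2 μ := by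
  have := holderTriple_four
  simp only [Matrix.mul_apply, Matrix.transpose_apply]
  exact memLp_finsetSum _ fun k _ => (hXm n j k).mul (hXm n i k)

theorem memLp_Xy (hXm : ∀ n i j, MemLp (fun ω => X n ω i j) 4 μ)
    (hym : ∀ n i, MemLp (fun ω => y n ω i) 4 μ) (n : ℕ) (i : Fin N) :
    MemLp (fun ω => app (X n ω) (y n ω) i) 2 μ := by
  have := holderTriple_four
  simp only [app_eq, Matrix.mulVec, dotProduct]
  exact memLp_finsetSum _ fun k _ => (hym n k).mul (hXm n i k)

variable [IsProbabilityMeasure μ]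

theorem cost_eq (reg : Regularizer N) (hXm : ∀ n i j, MemLp (fun ω => X n ω i j) 4 μ)
    (hym : ∀ n i, MemLp (fun ω => y n ω i) 4 μ) (h : Vec N) : cost X y μ reg h
    = 1 / 2 * inner ℝ h (toCLM (momentXX X μ + reg.V₀) h) - inner ℝ (momentXY X y μ + reg.v₀) h
      + penalty reg.ψ reg.L reg.v h + 1 / 2 * momentY y μ := by
  have hi1 : Integrable (fun ω => ‖y 0 ω‖ ^ 2) μ := by
    simp only [EuclideanSpace.norm_sq_eq, Real.norm_eq_abs, sq_abs]
    exact integrable_finsetSum _ fun i _ =>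
      ((hym 0 i).mono_exponent (p := 2) (by norm_num)).integrable_sq
  have hi2 : ∀ i, Integrable (fun ω => h i * app (X 0 ω) (y 0 ω) i) μ := fun i =>
    ((memLp_Xy hXm hym 0 i).integrable (by norm_num)).const_mul _
  have hi3 : ∀ i j, Integrable (fun ω => h i * h j * (X 0 ω * (X 0 ω)ᵀ) i j) μ := fun i j =>
    ((memLp_XX hXm 0 i j).integrable (by norm_num)).const_mul _
  have e2 : ∀ w : Vec N, inner ℝ w h = ∑ i, h i * w i := fun w => by
    simp [PiLp.inner_apply]
  have i2 : Integrable (fun ω => inner ℝ (app (X 0 ω) (y 0 ω)) h) μ := by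
    simp only [e2]
    exact integrable_finsetSum _ fun i _ => hi2 i
  have i3 : Integrable (fun ω => inner ℝ h (app (X 0 ω * (X 0 ω)ᵀ) h)) μ := by
    simp only [inner_app_eq_sum]
    exact integrable_finsetSum _ fun i _ => integrable_finsetSum _ fun j _ => hi3 i j
  have s2 : ∫ ω, inner ℝ (app (X 0 ω) (y 0 ω)) h ∂μ = inner ℝ (momentXY X y μ) h := by
    simp only [e2]
    rw [integral_finsetSum _ fun i _ => hi2 i]
    simp only [integral_const_mul]
    rfl
  have s3 : ∫ ω, inner ℝ h (app (X 0 ω * (X 0 ω)ᵀ) h) ∂μ = inner ℝ h (app (momentXX X μ) h) := by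
    simp only [inner_app_eq_sum]
    rw [integral_finsetSum _ fun i _ => integrable_finsetSum _ fun j _ => hi3 i j]
    refine Finset.sum_congr rfl fun i _ => ?_
    rw [integral_finsetSum _ fun j _ => hi3 i j]
    simp only [integral_const_mul]
    rfl
  have i4 : Integrable (fun ω => ‖y 0 ω‖ ^ 2 - 2 * inner ℝ (app (X 0 ω) (y 0 ω)) h) μ :=
    hi1.sub (i2.const_mul 2)
  simp only [cost, norm_residual_sq]
  rw [integral_add i4 i3, integral_sub hi1 (i2.const_mul 2), integral_const_mul, s2, s3,
    Regularizer.Ψ_eq, toCLM_apply, app_add, inner_add_right, inner_add_left, momentY]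
  ring

end Observations

/-! ### The iterates -/

section Iterates

variable {Ω : Type*} {N Q : ℕ} {X : ℕ → Ω → Matrix (Fin N) (Fin Q) ℝ} {y : ℕ → Ω → Vec Q}
  [MeasurableSpace Ω] {μ : Measure Ω} {reg : Regularizer N} {M : ℕ → ℕ}
  {D : (n : ℕ) → Ω → Matrix (Fin N) (Fin (M n)) ℝ} {h : ℕ → Ω → Vec N}

/-- If the curvature is injective on `ran D`, the iterate is `limitSolution` of measurable data.
Otherwise a kernel vector can be added to a minimizer, and the selection hypothesis supplies the
measurable version. -/
theorem exists_measurable_succ (h₁ : reg.Assumption1) (hh : IsMMSubspaceSequence X y μ reg M D h)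
    (hD : ∀ n i j, Measurable[dataSigma X y n] (fun ω => D n ω i j)) {n : ℕ} {g : Ω → Vec N}
    (hg : Measurable[dataSigma X y n] g) (hgh : h n =ᵐ[μ] g) :
    ∃ g' : Ω → Vec N, Measurable[dataSigma X y n] g' ∧ h (n + 1) =ᵐ[μ] g' := by
  classical
  obtain ⟨f, hf, hfh⟩ := hh.selection n
  have hdata : ∀ k ≤ n, Measurable[dataSigma X y n] fun ω => (X k ω, y k ω) :=
    fun k hk => measurable_dataSigma hk
  have hXk : ∀ k ≤ n, Measurable[dataSigma X y n] (X k) := fun k hk =>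
    measurable_fst.comp (hdata k hk)
  have hyk : ∀ k ≤ n, Measurable[dataSigma X y n] (y k) := fun k hk =>
    measurable_snd.comp (hdata k hk)
  set q : Ω → QuadraticData N (M n) := fun ω => (curvature reg (X · ω) n (g ω), D n ω,
    sampleVec reg (X · ω) (y · ω) n + penaltyVec reg.ψ reg.L reg.v (g ω)) with hqdef
  have hA := @measurable_curvature _ (dataSigma X y n) _ _ _ _ _ _ h₁ hXk hg
  have hDm := @measurable_matrix_of_entries _ (dataSigma X y n) _ _ (D n) (hD n)
  have hs := @measurable_sampleVec _ (dataSigma X y n) _ _ reg _ _ _ hXk hyk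
  have hp : Measurable[dataSigma X y n] fun ω => penaltyVec reg.ψ reg.L reg.v (g ω) :=
    (continuous_penaltyVec h₁.isPotential).measurable.comp hg
  have hq : Measurable[dataSigma X y n] q := hA.prodMk (hDm.prodMk (hs.add hp))
  refine ⟨fun ω => if ω ∈ q ⁻¹' injectiveData N (M n) then limitSolution (q ω) else f ω,
    Measurable.ite (hq measurableSet_injectiveData) (measurable_limitSolution.comp hq) hf, ?_⟩
  filter_upwards [hh.mem_argmin, hfh, hgh] with ω hmin hsel hω
  have hmin := hmin n
  split_ifs with hinj
  · have := (mem_argminSurrogate_iff _ _ h₁ n (h n ω) (D n ω) _).1 hmin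
    rw [hω] at this
    exact (limitSolution_eq (q := q ω) (posSemidef_curvature _ h₁ n (g ω)) hinj this.1 this.2).symm
  · refine hsel ?_
    have hinj' : ¬ ∀ w ∈ ran (D n ω), app (curvature reg (X · ω) n (g ω)) w = 0 → w = 0 := hinj
    push Not at hinj'
    obtain ⟨w, hw, hAw, hw0⟩ := hinj'
    rw [← hω] at hAw
    exact not_subsingleton_argminSurrogate _ _ h₁ hmin hw hAw hw0

/-- The iterates are, up to null sets, non-anticipative. -/
theorem exists_measurable_iterates (h₁ : reg.Assumption1)
    (hh : IsMMSubspaceSequence X y μ reg M D h) (h₃ : Assumption3 X y μ reg M D h) :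
    ∃ g : ℕ → Ω → Vec N, (∀ n, Measurable[dataSigma X y n] (g n)) ∧
      ∀ᵐ ω ∂μ, ∀ n, h (n + 1) ω = g n ω := by
  have hex : ∀ n, ∃ g : Ω → Vec N, Measurable[dataSigma X y n] g ∧ h n =ᵐ[μ] g := by
    intro n
    induction n with
    | zero => exact ⟨h 0, h₃.measurable_init, EventuallyEq.rfl⟩
    | succ n ih =>
      obtain ⟨g, hg, hgh⟩ := ih
      obtain ⟨g', hg', hgh'⟩ := exists_measurable_succ h₁ hh h₃.measurable_D hg hgh
      exact ⟨g', hg'.mono (dataSigma_mono n.le_succ) le_rfl, hgh'⟩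
  -- One index earlier than in `hex`: this makes `h (n + 1)` an admissible weight for the
  -- observation of index `n + 1`.
  have hex' : ∀ n, ∃ g : Ω → Vec N, Measurable[dataSigma X y n] g ∧ h (n + 1) =ᵐ[μ] g := by
    intro n
    obtain ⟨g, hg, hgh⟩ := hex n
    exact exists_measurable_succ h₁ hh h₃.measurable_D hg hgh
  choose g hg hgh using hex'
  exact ⟨g, hg, ae_all_iff.2 hgh⟩

theorem mean_sub_const (u : ℕ → ℝ) (a : ℝ) (n : ℕ) :
    ((n : ℝ) + 1)⁻¹ * ∑ k ∈ Finset.range (n + 1), (u k - a)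
      = ((n : ℝ) + 1)⁻¹ * ∑ k ∈ Finset.range (n + 1), u k - a := by
  have : (n : ℝ) + 1 ≠ 0 := by positivity
  rw [Finset.sum_sub_distrib, Finset.sum_const, Finset.card_range, nsmul_eq_mul]
  push_cast
  field_simp

theorem sampleR_apply (x : ℕ → Matrix (Fin N) (Fin Q) ℝ) (a : ℝ) (n : ℕ) (i j : Fin N) :
    sampleR x n i j
      = ((n : ℝ) + 1)⁻¹ * ∑ k ∈ Finset.range (n + 1), ((x k * (x k)ᵀ) i j - a) + a := by
  rw [mean_sub_const, sub_add_cancel, sampleR, Matrix.smul_apply, Matrix.sum_apply, smul_eq_mul]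

theorem sampleVec_apply (x : ℕ → Matrix (Fin N) (Fin Q) ℝ) (w : ℕ → Vec Q) (a : ℝ) (n : ℕ)
    (i : Fin N) : sampleVec reg x w n i
      = ((n : ℝ) + 1)⁻¹ * ∑ k ∈ Finset.range (n + 1), (app (x k) (w k) i - a) + a + reg.v₀ i := by
  rw [mean_sub_const, sub_add_cancel, sampleVec]
  simp

variable [IsProbabilityMeasure μ] (hX : ∀ n, Measurable (X n)) (hy : ∀ n, Measurable (y n))
include hX hy

theorem isMartingaleDifference_XX (h₃ : Assumption3 X y μ reg M D h) (i j : Fin N) :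
    ∃ C, IsMartingaleDifference (dataFiltration hX hy) μ
      (fun n ω => (X n ω * (X n ω)ᵀ) i j - momentXX X μ i j) C := by
  have hc : Continuous fun A : Matrix (Fin N) (Fin Q) ℝ => (A * Aᵀ) i j :=
    (continuous_id.matrix_mul continuous_id.matrix_transpose).matrix_elem i j
  exact ⟨_, isMartingaleDifference_of_condExp hX hy h₃.stationary_ergodic
    (φ := fun q => (q.1 * (q.1)ᵀ) i j) (hc.measurable.comp measurable_fst)
    (fun n => memLp_XX h₃.moment_X n i j) (fun n => h₃.condExp_XX n i j)⟩

theorem isMartingaleDifference_Xy (h₃ : Assumption3 X y μ reg M D h) (i : Fin N) :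
    ∃ C, IsMartingaleDifference (dataFiltration hX hy) μ
      (fun n ω => app (X n ω) (y n ω) i - momentXY X y μ i) C := by
  have hm : Measurable fun q : Matrix (Fin N) (Fin Q) ℝ × Vec Q => app q.1 q.2 i :=
    (EuclideanSpace.proj (𝕜 := ℝ) i).measurable.comp measurable_app_prod
  exact ⟨_, isMartingaleDifference_of_condExp hX hy h₃.stationary_ergodic
    (φ := fun q => app q.1 q.2 i) hm
    (fun n => memLp_Xy h₃.moment_X h₃.moment_y n i) (fun n => h₃.condExp_Xy n i)⟩

theorem ae_tendsto_sampleR (h₃ : Assumption3 X y μ reg M D h) :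
    ∀ᵐ ω ∂μ, Tendsto (fun n => sampleR (X · ω) n) atTop (𝓝 (momentXX X μ)) := by
  have hae : ∀ᵐ ω ∂μ, ∀ i j, Tendsto (fun n : ℕ => ((n : ℝ) + 1)⁻¹ *
      ∑ k ∈ Finset.range (n + 1), ((X k ω * (X k ω)ᵀ) i j - momentXX X μ i j)) atTop (𝓝 0) := by
    rw [ae_all_iff]; intro i
    rw [ae_all_iff]; intro j
    obtain ⟨C, hC⟩ := isMartingaleDifference_XX hX hy h₃ i j
    exact hC.ae_tendsto_mean
  filter_upwards [hae] with ω hω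
  refine tendsto_pi_nhds.2 fun i => tendsto_pi_nhds.2 fun j => ?_
  have := (hω i j).add_const (momentXX X μ i j)
  rw [zero_add] at this
  exact this.congr fun n => (sampleR_apply (X · ω) _ n i j).symm

theorem ae_tendsto_sampleVec (h₃ : Assumption3 X y μ reg M D h) :
    ∀ᵐ ω ∂μ, Tendsto (fun n => sampleVec reg (X · ω) (y · ω) n) atTop
      (𝓝 (momentXY X y μ + reg.v₀)) := by
  have hae : ∀ᵐ ω ∂μ, ∀ i, Tendsto (fun n : ℕ => ((n : ℝ) + 1)⁻¹ *
      ∑ k ∈ Finset.range (n + 1), (app (X k ω) (y k ω) i - momentXY X y μ i)) atTop (𝓝 0) := by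
    rw [ae_all_iff]; intro i
    obtain ⟨C, hC⟩ := isMartingaleDifference_Xy hX hy h₃ i
    exact hC.ae_tendsto_mean
  filter_upwards [hae] with ω hω
  have h1 : Tendsto (fun n => (sampleVec reg (X · ω) (y · ω) n).ofLp) atTop
      (𝓝 (momentXY X y μ + reg.v₀).ofLp) := by
    refine tendsto_pi_nhds.2 fun i => ?_
    have := ((hω i).add_const (momentXY X y μ i)).add_const (reg.v₀ i)
    rw [zero_add] at this
    exact this.congr fun n => (sampleVec_apply (X · ω) (y · ω) _ n i).symm
  exact ((PiLp.continuous_toLp 2 _).tendsto _).comp h1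

/-- Along bounded iterates, the fluctuations of the cost due to the new observations have bounded
partial sums. -/
theorem ae_bounded_sum_increments (h₁ : reg.Assumption1)
    (hh : IsMMSubspaceSequence X y μ reg M D h) (h₃ : Assumption3 X y μ reg M D h)
    (hbdd : ∀ᵐ ω ∂μ, ∃ K, ∀ n, ‖h n ω‖ ≤ K) :
    ∀ᵐ ω ∂μ, ∃ K, ∀ m, |∑ n ∈ Finset.range m,
      (1 / 2 * inner ℝ (h (n + 1) ω) ((toCLM (sampleR (X · ω) (n + 1) + reg.V₀)
          - toCLM (sampleR (X · ω) n + reg.V₀)) (h (n + 1) ω))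
        - inner ℝ (sampleVec reg (X · ω) (y · ω) (n + 1) - sampleVec reg (X · ω) (y · ω) n)
          (h (n + 1) ω))| ≤ K := by
  obtain ⟨g, hg, hgh⟩ := exists_measurable_iterates h₁ hh h₃
  have hgi : ∀ n i, StronglyMeasurable[dataFiltration hX hy n] fun ω => g n ω i := fun n i =>
    ((EuclideanSpace.proj (𝕜 := ℝ) i).measurable.comp (hg n)).stronglyMeasurable
  have hcoord : ∀ (z : Vec N) i, |z i| ≤ ‖z‖ := fun z i => by
    simpa using PiLp.norm_apply_le z i
  -- In coordinates, the quadratic part is a finite combination of weighted increments of scalar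
  -- means, with predictable bounded weights `g n ω i * g n ω j`.
  have hR : ∀ᵐ ω ∂μ, ∀ i j, ∃ l, Tendsto (fun m => ∑ n ∈ Finset.range m,
      (g n ω i * g n ω j) * (sampleR (X · ω) (n + 1) i j - sampleR (X · ω) n i j))
      atTop (𝓝 l) := by
    rw [ae_all_iff]; intro i
    rw [ae_all_iff]; intro j
    obtain ⟨C, hC⟩ := isMartingaleDifference_XX hX hy h₃ i j
    have hb : ∀ᵐ ω ∂μ, ∃ K, ∀ n, |g n ω i * g n ω j| ≤ K := by
      filter_upwards [hbdd, hgh] with ω ⟨K, hK⟩ hω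
      refine ⟨K * K, fun n => ?_⟩
      rw [← hω, abs_mul]
      have h1 := hcoord (h (n + 1) ω)
      have h2 := hK (n + 1)
      exact mul_le_mul ((h1 i).trans h2) ((h1 j).trans h2) (abs_nonneg _)
        ((norm_nonneg _).trans h2)
    filter_upwards [hC.ae_exists_tendsto_increments (fun n => (hgi n i).mul (hgi n j)) hb]
      with ω ⟨l, hl⟩
    refine ⟨l, hl.congr fun m => Finset.sum_congr rfl fun n _ => ?_⟩
    rw [sampleR_apply _ (momentXX X μ i j) (n + 1), sampleR_apply _ (momentXX X μ i j) n,
      add_sub_add_right_eq_sub]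
    rfl
  have hr : ∀ᵐ ω ∂μ, ∀ i, ∃ l, Tendsto (fun m => ∑ n ∈ Finset.range m,
      g n ω i * (sampleVec reg (X · ω) (y · ω) (n + 1) i - sampleVec reg (X · ω) (y · ω) n i))
      atTop (𝓝 l) := by
    rw [ae_all_iff]; intro i
    obtain ⟨C, hC⟩ := isMartingaleDifference_Xy hX hy h₃ i
    have hb : ∀ᵐ ω ∂μ, ∃ K, ∀ n, |g n ω i| ≤ K := by
      filter_upwards [hbdd, hgh] with ω ⟨K, hK⟩ hω
      exact ⟨K, fun n => by rw [← hω]; exact (hcoord _ i).trans (hK _)⟩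
    filter_upwards [hC.ae_exists_tendsto_increments (fun n => hgi n i) hb] with ω ⟨l, hl⟩
    refine ⟨l, hl.congr fun m => Finset.sum_congr rfl fun n _ => ?_⟩
    rw [sampleVec_apply _ _ (momentXY X y μ i) (n + 1), sampleVec_apply _ _ (momentXY X y μ i) n,
      add_sub_add_right_eq_sub, add_sub_add_right_eq_sub]
  filter_upwards [hR, hr, hgh] with ω hR hr hω
  choose lR hlR using hR
  choose lr hlr using hr
  have hlim : Tendsto (fun m => 1 / 2 * ∑ i, ∑ j, ∑ n ∈ Finset.range m,
      (g n ω i * g n ω j) * (sampleR (X · ω) (n + 1) i j - sampleR (X · ω) n i j)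
      - ∑ i, ∑ n ∈ Finset.range m, g n ω i *
        (sampleVec reg (X · ω) (y · ω) (n + 1) i - sampleVec reg (X · ω) (y · ω) n i)) atTop
      (𝓝 (1 / 2 * ∑ i, ∑ j, lR i j - ∑ i, lr i)) :=
    ((tendsto_finsetSum _ fun i _ => tendsto_finsetSum _ fun j _ => hlR i j).const_mul _).sub
      (tendsto_finsetSum _ fun i _ => hlr i)
  obtain ⟨K, hK⟩ := hlim.abs.bddAbove_range
  refine ⟨K, fun m => ?_⟩
  have hm := hK (mem_range_self m)
  refine le_of_eq_of_le ?_ hm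
  simp only
  congr 1
  have c1 : ∀ F : Fin N → Fin N → ℕ → ℝ, ∑ i, ∑ j, ∑ n ∈ Finset.range m, F i j n
      = ∑ n ∈ Finset.range m, ∑ i, ∑ j, F i j n := fun F =>
    (Finset.sum_congr rfl fun i _ => Finset.sum_comm).trans Finset.sum_comm
  have c2 : ∀ F : Fin N → ℕ → ℝ, ∑ i, ∑ n ∈ Finset.range m, F i n
      = ∑ n ∈ Finset.range m, ∑ i, F i n := fun F => Finset.sum_comm
  rw [c1, c2, Finset.mul_sum, ← Finset.sum_sub_distrib]
  refine Finset.sum_congr rfl fun n _ => ?_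
  rw [← toCLM_sub, add_sub_add_right_eq_sub, toCLM_apply, inner_app_eq_sum, hω n]
  congr 1

end Iterates

/-! ### Almost sure behaviour of the iterates -/

section Convergence

variable {Ω : Type*} {N Q : ℕ} {X : ℕ → Ω → Matrix (Fin N) (Fin Q) ℝ} {y : ℕ → Ω → Vec Q}
  [MeasurableSpace Ω] {μ : Measure Ω} [IsProbabilityMeasure μ] {reg : Regularizer N} {M : ℕ → ℕ}
  {D : (n : ℕ) → Ω → Matrix (Fin N) (Fin (M n)) ℝ} {h : ℕ → Ω → Vec N}

/-- Almost surely, the iterates are bounded, and their cluster points form a nonempty compact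
connected set of solutions of the critical point equation. -/
theorem ae_clusterPoints_properties (hX : ∀ n, Measurable (X n)) (hy : ∀ n, Measurable (y n))
    (hh : IsMMSubspaceSequence X y μ reg M D h) (h₁ : reg.Assumption1)
    (h₂ : Assumption2 X y μ reg M D h) (h₃ : Assumption3 X y μ reg M D h) :
    ∀ᵐ ω ∂μ, (∃ K, ∀ n, ‖h n ω‖ ≤ K) ∧ (clusterPoints (h · ω)).Nonempty ∧
      IsCompact (clusterPoints (h · ω)) ∧ IsConnected (clusterPoints (h · ω)) ∧
      ∀ z ∈ clusterPoints (h · ω), toCLM (momentXX X μ + reg.V₀) z - (momentXY X y μ + reg.v₀)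
        + (penaltyOp reg.ψ reg.L reg.v z z - penaltyVec reg.ψ reg.L reg.v z) = 0 := by
  obtain ⟨α, hα, hpos⟩ := exists_coercive_of_posDef h₃.posDef
  have hdesc : ∀ᵐ ω ∂μ, IsSubspaceDescent (penaltyOp reg.ψ reg.L reg.v)
      (penaltyVec reg.ψ reg.L reg.v) (fun n => toCLM (sampleR (X · ω) n + reg.V₀))
      (sampleVec reg (X · ω) (y · ω)) (fun n => ran (D n ω)) (h · ω) := by
    filter_upwards [hh.mem_argmin, h₂] with ω hmin hmem
    exact isSubspaceDescent _ _ h₁ hmin hmem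
  have hB : ∀ᵐ ω ∂μ, Tendsto (fun n => toCLM (sampleR (X · ω) n + reg.V₀)) atTop
      (𝓝 (toCLM (momentXX X μ + reg.V₀))) := by
    filter_upwards [ae_tendsto_sampleR hX hy h₃] with ω hω
    exact (continuous_toCLM.tendsto _).comp (hω.add_const _)
  have hc := ae_tendsto_sampleVec hX hy h₃
  -- Boundedness uses only the limits of the means, so it is available for the martingale weights
  -- without circularity.
  have hbdd : ∀ᵐ ω ∂μ, ∃ K, ∀ n, ‖h n ω‖ ≤ K := by
    filter_upwards [hdesc, hB, hc] with ω hd hB hc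
    exact hd.isBounded_range h₁.isQuadraticallyMajorized hα hB hpos hc
  filter_upwards [hdesc, hB, hc, hbdd, ae_bounded_sum_increments hX hy h₁ hh h₃ hbdd]
    with ω hd hB hc hb hs
  exact ⟨hb, hd.clusterPoints_properties h₁.isQuadraticallyMajorized hα hB hpos hc hs⟩

end Convergence

end OnlineMM

theorem proposition2 {Ω : Type*} [MeasurableSpace Ω] (μ : Measure Ω) [IsProbabilityMeasure μ]
    {N Q : ℕ} (reg : OnlineMM.Regularizer N)
    (X : ℕ → Ω → Matrix (Fin N) (Fin Q) ℝ) (y : ℕ → Ω → OnlineMM.Vec Q)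
    (hX : ∀ n, Measurable (X n)) (hy : ∀ n, Measurable (y n))
    (M : ℕ → ℕ) (D : (n : ℕ) → Ω → Matrix (Fin N) (Fin (M n)) ℝ) (h : ℕ → Ω → OnlineMM.Vec N)
    (hh : OnlineMM.IsMMSubspaceSequence X y μ reg M D h)
    (h₁ : reg.Assumption1)
    (h₂ : OnlineMM.Assumption2 X y μ reg M D h)
    (h₃ : OnlineMM.Assumption3 X y μ reg M D h) :
    (∀ᵐ ω ∂μ,
      (OnlineMM.clusterPoints (h · ω)).Nonempty ∧
      IsCompact (OnlineMM.clusterPoints (h · ω)) ∧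
      IsConnected (OnlineMM.clusterPoints (h · ω))) ∧
    (∀ᵐ ω ∂μ, ∀ z ∈ OnlineMM.clusterPoints (h · ω),
      HasGradientAt (OnlineMM.cost X y μ reg) 0 z) ∧
    ((∀ s, ConvexOn ℝ Set.univ (reg.ψ s)) →
      ∃ z : OnlineMM.Vec N,
        (∀ z', z' ≠ z → OnlineMM.cost X y μ reg z < OnlineMM.cost X y μ reg z') ∧
        ∀ᵐ ω ∂μ, Tendsto (h · ω) atTop (𝓝 z)) := by
  have key := OnlineMM.ae_clusterPoints_properties hX hy hh h₁ h₂ h₃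
  have hcost := OnlineMM.cost_eq reg h₃.moment_X h₃.moment_y
  have hpsd := h₃.posDef.posSemidef
  refine ⟨?_, ?_, fun hconv => ?_⟩
  · filter_upwards [key] with ω hω
    exact ⟨hω.2.1, hω.2.2.1, hω.2.2.2.1⟩
  · filter_upwards [key] with ω hω z hz
    have := OnlineMM.hasGradientAt_quadratic_add_penalty h₁ hpsd
      (OnlineMM.momentXY X y μ + reg.v₀) (1 / 2 * OnlineMM.momentY y μ) z
    rwa [hω.2.2.2.2 z hz, ← funext hcost] at this
  · obtain ⟨α, hα, hpos⟩ := OnlineMM.exists_coercive_of_posDef h₃.posDef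
    have hstrict : ∀ z, OnlineMM.toCLM (OnlineMM.momentXX X μ + reg.V₀) z
        - (OnlineMM.momentXY X y μ + reg.v₀) + (OnlineMM.penaltyOp reg.ψ reg.L reg.v z z
          - OnlineMM.penaltyVec reg.ψ reg.L reg.v z) = 0 →
        ∀ z', z' ≠ z → OnlineMM.cost X y μ reg z < OnlineMM.cost X y μ reg z' := by
      intro z hz z' hne
      have := OnlineMM.lt_of_critical hα (OnlineMM.symm_toCLM hpsd) hpos
        (OnlineMM.le_penalty_of_convexOn (L := reg.L) (v := reg.v) h₁.isPotential hconv z) hz hne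
      rw [hcost, hcost]
      linarith
    -- The minimizer is found as a cluster point of a single good trajectory; it is deterministic
    -- because the critical point equation does not involve `ω`.
    obtain ⟨ω₀, hω₀⟩ := key.exists
    obtain ⟨z, hz⟩ := hω₀.2.1
    have hzmin := hstrict z (hω₀.2.2.2.2 z hz)
    refine ⟨z, hzmin, ?_⟩
    filter_upwards [key] with ω hω
    obtain ⟨K, hK⟩ := hω.1
    refine (isCompact_closedBall (0 : OnlineMM.Vec N) K).tendsto_nhds_of_unique_mapClusterPt
      (Eventually.of_forall fun n => by simpa using hK n) fun z' _ hz' => ?_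
    -- Two distinct critical points would each have strictly smaller cost than the other.
    by_contra hne
    exact lt_asymm (hzmin z' hne) (hstrict z' (hω.2.2.2.2 z' hz') z (Ne.symm hne))
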